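/- Let $D>0$ be the discriminant of a real quadratic field $K=\mathbb{Q}(\sqrt D)\subset\mathbb{R}$, let $H^+(K)$ be its narrow class group (fractional ideals modulo principal ideals with a totally positive generator), let $\widehat{H^+(K)}$ be the group of characters $\psi\colon H^+(K)\to\mathbb{C}^\times$, and let $\varepsilon_D>1$ be the generator of the group of totally positive units of $K$. For a primitive integral form $Q=[a,b,c]$ of discriminant $D$ let $\omega_Q>\omega_Q^*$ be the roots of $ax^2+bx+c$, let $\tilde\gamma_Q=\{z\in\mathbb{H} : a|z|^2+b\,\mathrm{Re}(z)+c=0\}$ be the geodesic joining them, and let $$\kappa_Q=\frac1{\sqrt{\omega_Q-\omega_Q^*}}\begin{pmatrix}1&-\omega_Q\\1&-\omega_Q^*\end{pmatrix}\in \mathrm{SL}_2(\mathbb{R}),$$ which maps $\tilde\gamma_Q$ onto $i\mathbb{R}_{>0}$. Each $\mathrm{SL}_2(\mathbb{Z})$-class of such forms $Q$ defines a closed geodesic $\gamma_Q$ of $\mathrm{SL}_2(\mathbb{Z})\backslash\mathbb{H}$, the quotient of $\tilde\gamma_Q$ by the stabilizer of $Q$ in $\mathrm{SL}_2(\mathbb{Z})$;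 it has length $\log(\varepsilon_D^2)$. Let $\mathcal{C}_D$ be the union of these closed geodesics over all classes of forms of discriminant $D$, taken as a disjoint union of closed curves (so $\mathcal{C}_D$ is the set of pairs $(Q,z)$ with $z\in\tilde\gamma_Q$, modulo $\mathrm{SL}_2(\mathbb{Z})$, and a function on the image of $\mathcal{C}_D$ in $\mathrm{SL}_2(\mathbb{Z})\backslash\mathbb{H}$ is regarded as a function on $\mathcal{C}_D$ by composition). Let $ds$ be the hyperbolic arc length measure on $\mathcal{C}_D$, $|\mathcal{C}_D|$ its total mass, and $\|\cdot\|_2$ the norm of $L^2(\mathcal{C}_D,ds)$. The form $Q=[a,b,c]$ is attached to the narrow class of the fractional ideal $\big(a,\tfrac{-b+\sqrt D}{2}\big)$ if $a>0$, and of $\sqrt D\cdot\big(a,\tfrac{-b+\sqrt D}{2}\big)$ if $a<0$. For each $[\mathfrak a]\in H^+(K)$ there is a form attached to $[\mathfrak a]$. Choose one such form $Q_{[\mathfrak a]}$ for every $[\mathfrak a]$ (equivalently, a lift $\tilde\gamma_{[\mathfrak a]}$ to $\mathbb{H}$ of the closed geodesic $\gamma_{[\mathfrak a]}$ corresponding to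 $[\mathfrak a]$), and write $\kappa_{[\mathfrak a]}=\kappa_{Q_{[\mathfrak a]}}$. For $g\in L^2(\mathcal{C}_D)$, $\psi\in\widehat{H^+(K)}$ and $n\in\mathbb{Z}$ put $$I(g,\chi_{\psi,n})=\Big|\sum_{[\mathfrak a]\in H^+(K)}\psi([\mathfrak a])^{-1}\int_1^{\varepsilon_D^2}g(\kappa_{[\mathfrak a]}^{-1}iy)\,y^{-\frac{n\pi i}{\log\varepsilon_D}}\,\frac{dy}{y}\Big|^2 ,$$ where $g(\kappa_{[\mathfrak a]}^{-1}iy)$ is the value of $g$ at the point of $\gamma_{[\mathfrak a]}$ represented by $\kappa_{[\mathfrak a]}^{-1}iy$. **Theorem (restriction norm formula).** For every such choice of the forms $Q_{[\mathfrak a]}$ and every $g\in L^2(\mathcal{C}_D)$, the integrals above converge absolutely, the series over $n\in\mathbb{Z}$ below converge, and $$\|g\|_2^2=\frac1{|\mathcal{C}_D|}\sum_{\psi\in\widehat{H^+(K)}}\ \sum_{n\in\mathbb{Z}}I(g,\chi_{\psi,n}).$$ -/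

import Mathlib

open MeasureTheory
open scoped UpperHalfPlane MatrixGroups nonZeroDivisors NumberField

noncomputable section

namespace RestrictionNorm

/-- `D` is the discriminant of a quadratic number field. -/
def IsFundamentalDiscriminant (D : ℤ) : Prop :=
  (D % 4 = 1 ∧ Squarefree D ∧ D ≠ 1) ∨
    (D % 4 = 0 ∧ (D / 4 % 4 = 2 ∨ D / 4 % 4 = 3) ∧ Squarefree (D / 4))

/-- `D` is a positive fundamental discriminant. -/
class PosFundDisc (D : ℤ) : Prop where
  pos : 0 < D
  fundamental : IsFundamentalDiscriminant D

theorem not_sq_of_fundamental {D : ℤ} (h : IsFundamentalDiscriminant D) (b : ℤ) : b * b ≠ D := by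
  rintro rfl
  rcases h with ⟨-, h2, h3⟩ | ⟨h1, h2, h3⟩
  · rcases Int.isUnit_iff.1 (h2 b dvd_rfl) with rfl | rfl <;> simp at h3
  · obtain ⟨k, hk | hk⟩ := Int.even_or_odd' b
    · subst hk
      have e : 2 * k * (2 * k) / 4 = k * k := by
        rw [show 2 * k * (2 * k) = 4 * (k * k) by ring]; simp
      rw [e] at h2 h3
      rcases Int.isUnit_iff.1 (h3 k dvd_rfl) with rfl | rfl <;> simp at h2
    · subst hk
      rw [show (2 * k + 1) * (2 * k + 1) = 4 * (k * k + k) + 1 by ring] at h1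
      omega

/-! ### The field, its totally positive units, and its narrow class group -/

/-- The quadratic field `ℚ(√D)`, as a subfield of `ℝ`. -/
abbrev QField (D : ℤ) : IntermediateField ℚ ℝ := IntermediateField.adjoin ℚ {√(D : ℝ)}

theorem isIntegral_sqrt (D : ℤ) : IsIntegral ℚ (√(D : ℝ)) := by
  rcases le_or_gt 0 D with h | h
  · have hz : IsIntegral ℚ ((D : ℝ)) := by
      simpa using (isIntegral_algebraMap (R := ℚ) (A := ℝ) (x := (D : ℚ)))
    refine IsIntegral.of_pow (n := 2) (by norm_num) ?_
    rw [Real.sq_sqrt (by exact_mod_cast h)]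
    exact hz
  · rw [Real.sqrt_eq_zero_of_nonpos (by exact_mod_cast h.le)]
    exact isIntegral_zero

instance instNumberFieldQField (D : ℤ) : NumberField (QField D) where
  to_charZero := inferInstance
  to_finiteDimensional := IntermediateField.adjoin.finiteDimensional (isIntegral_sqrt D)

/-- The element `√D` of `ℚ(√D)`. -/
def sqrtD (D : ℤ) : QField D :=
  ⟨√(D : ℝ), IntermediateField.mem_adjoin_simple_self ℚ (√(D : ℝ))⟩

theorem sqrtD_ne_zero (D : ℤ) [hD : PosFundDisc D] : sqrtD D ≠ 0 := by
  intro h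
  have h1 : √(D : ℝ) = 0 := congrArg Subtype.val h
  have h2 : (0 : ℝ) < D := by exact_mod_cast hD.pos
  exact (Real.sqrt_pos.2 h2).ne' h1

/-- The totally positive elements of `ℚ(√D)ˣ`: those positive in every real embedding. -/
def totallyPositive (D : ℤ) : Subgroup (QField D)ˣ where
  carrier := {x | ∀ σ : QField D →+* ℝ, 0 < σ x}
  one_mem' := by simp
  mul_mem' := by
    intro x y hx hy σ
    simpa using mul_pos (hx σ) (hy σ)
  inv_mem' := by
    intro x hx σ
    simpa using inv_pos.2 (hx σ)

/-- The group `U⁺` of totally positive units of the ring of integers. -/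
def totallyPositiveUnits (D : ℤ) : Subgroup (𝓞 (QField D))ˣ :=
  (totallyPositive D).comap (Units.map (algebraMap (𝓞 (QField D)) (QField D)).toMonoidHom)

/-- The real number `ε_D > 1` which generates the (infinite cyclic) group `U⁺`. -/
def epsilonD (D : ℤ) : ℝ :=
  Classical.epsilon fun x : ℝ => 1 < x ∧ ∃ u : (𝓞 (QField D))ˣ,
    ((u : 𝓞 (QField D)) : QField D) = x ∧ Subgroup.zpowers u = totallyPositiveUnits D

/-- Principal fractional ideals with a totally positive generator. -/
def narrowPrincipal (D : ℤ) : Subgroup (FractionalIdeal (𝓞 (QField D))⁰ (QField D))ˣ :=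
  (totallyPositive D).map (toPrincipalIdeal (𝓞 (QField D)) (QField D))

/-- The narrow class group `H⁺` of `ℚ(√D)`: fractional ideals modulo the principal ones with a
totally positive generator. -/
def NarrowClassGroup (D : ℤ) : Type :=
  (FractionalIdeal (𝓞 (QField D))⁰ (QField D))ˣ ⧸ narrowPrincipal D

instance instCommGroupNarrowClassGroup (D : ℤ) : CommGroup (NarrowClassGroup D) :=
  inferInstanceAs
    (CommGroup ((FractionalIdeal (𝓞 (QField D))⁰ (QField D))ˣ ⧸ narrowPrincipal D))

instance instFiniteNarrowClassGroup (D : ℤ) : Finite (NarrowClassGroup D) := by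
  have h1 : (totallyPositive D).index ≠ 0 := by
    let f : (QField D)ˣ →* ((QField D →+* ℝ) → SignTypeˣ) :=
      MonoidHom.mk' (fun x σ => Units.map ((signHom (α := ℝ)).toMonoidHom.comp σ.toMonoidHom) x)
        (by intro x y; funext σ; simp)
    have hf : f.ker ≤ totallyPositive D := by
      intro x hx σ
      have h2 := congrArg Units.val (congrFun (MonoidHom.mem_ker.1 hx) σ)
      exact sign_eq_one_iff.1 h2
    have : f.ker.FiniteIndex := Subgroup.finiteIndex_ker f
    exact (Subgroup.finiteIndex_of_le hf).index_ne_zero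
  have h2 : (toPrincipalIdeal (𝓞 (QField D)) (QField D)).range.index ≠ 0 := by
    have : Finite ((FractionalIdeal (𝓞 (QField D))⁰ (QField D))ˣ ⧸
        (toPrincipalIdeal (𝓞 (QField D)) (QField D)).range) :=
      Finite.of_equiv _ (ClassGroup.equiv (R := 𝓞 (QField D)) (QField D)).toEquiv
    exact (Subgroup.finiteIndex_of_finite_quotient).index_ne_zero
  have h3 : (narrowPrincipal D).index ≠ 0 := by
    rw [narrowPrincipal, Subgroup.index_map]
    refine mul_ne_zero (fun h => h1 ?_) h2
    exact Nat.eq_zero_of_zero_dvd (h ▸ Subgroup.index_dvd_of_le le_sup_left)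
  have : (narrowPrincipal D).FiniteIndex := ⟨h3⟩
  exact Subgroup.finite_quotient_of_finiteIndex

instance instFintypeNarrowClassGroup (D : ℤ) : Fintype (NarrowClassGroup D) :=
  Fintype.ofFinite _

/-- There are finitely many class group characters. -/
instance instFintypeNarrowCharacters (D : ℤ) : Fintype (NarrowClassGroup D →* ℂˣ) :=
  Fintype.ofFinite _

/-! ### Binary quadratic forms -/

/-- A primitive integral binary quadratic form `a x² + b x y + c y²` of discriminant `D`. -/
@[ext]
structure QForm (D : ℤ) where
  a : ℤ
  b : ℤ
  c : ℤ
  primitive : Int.gcd (Int.gcd a b) c = 1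
  disc : b ^ 2 - 4 * a * c = D

instance instMeasurableSpaceQForm (D : ℤ) : MeasurableSpace (QForm D) := ⊤

namespace QForm

variable {D : ℤ}

/-- The value `Q(x, y)`. -/
def eval (Q : QForm D) (x y : ℤ) : ℤ := Q.a * x ^ 2 + Q.b * x * y + Q.c * y ^ 2

/-- `Q' = Q.A`, that is `Q'(x, y) = Q(A(x, y))`. -/
def IsTranslate (Q Q' : QForm D) (A : SL(2, ℤ)) : Prop :=
  ∀ x y : ℤ, Q'.eval x y = Q.eval (A 0 0 * x + A 0 1 * y) (A 1 0 * x + A 1 1 * y)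

theorem isTranslate_one (Q : QForm D) : Q.IsTranslate Q 1 := by
  intro x y
  simp

theorem IsTranslate.mul {Q Q' Q'' : QForm D} {A B : SL(2, ℤ)} (h : Q.IsTranslate Q' A)
    (h' : Q'.IsTranslate Q'' B) : Q.IsTranslate Q'' (A * B) := by
  intro x y
  rw [h' x y, h]
  congr 1 <;> simp [Matrix.mul_apply, Fin.sum_univ_two] <;> ring

theorem IsTranslate.inv {Q Q' : QForm D} {A : SL(2, ℤ)} (h : Q.IsTranslate Q' A) :
    Q'.IsTranslate Q A⁻¹ := by
  intro x y
  have hd : A 0 0 * A 1 1 - A 0 1 * A 1 0 = 1 := by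
    rw [← Matrix.det_fin_two]; exact A.det_coe
  rw [h]
  congr 1
  · simp [Matrix.SpecialLinearGroup.coe_inv, Matrix.adjugate_fin_two]
    linear_combination (-x) * hd
  · simp [Matrix.SpecialLinearGroup.coe_inv, Matrix.adjugate_fin_two]
    linear_combination (-y) * hd

theorem a_ne_zero [hD : PosFundDisc D] (Q : QForm D) : Q.a ≠ 0 := by
  intro h
  have := Q.disc
  rw [h] at this
  exact not_sq_of_fundamental hD.fundamental Q.b (by linarith)

/-- The fractional ideal generated by `a` and `(-b + √D) / 2`. -/
def ideal (Q : QForm D) : FractionalIdeal (𝓞 (QField D))⁰ (QField D) :=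
  FractionalIdeal.spanSingleton _ (Q.a : QField D) +
    FractionalIdeal.spanSingleton _ ((-(Q.b : QField D) + sqrtD D) / 2)

theorem ideal_ne_zero [PosFundDisc D] (Q : QForm D) : Q.ideal ≠ 0 := by
  intro h
  have h1 : FractionalIdeal.spanSingleton (𝓞 (QField D))⁰ (Q.a : QField D) ≤ Q.ideal :=
    le_sup_left
  rw [h] at h1
  have h2 : FractionalIdeal.spanSingleton (𝓞 (QField D))⁰ (Q.a : QField D) = 0 :=
    le_antisymm h1 bot_le
  rw [FractionalIdeal.spanSingleton_eq_zero_iff] at h2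
  exact Q.a_ne_zero (by exact_mod_cast h2)

/-- The natural map from forms to narrow ideal classes: the class of `(a, (-b + √D) / 2)` if
`a > 0`, and of `√D · (a, (-b + √D) / 2)` if `a < 0`. -/
def idealClass [PosFundDisc D] (Q : QForm D) : NarrowClassGroup D :=
  QuotientGroup.mk (s := narrowPrincipal D)
    (if 0 < Q.a then Units.mk0 Q.ideal Q.ideal_ne_zero
      else toPrincipalIdeal (𝓞 (QField D)) (QField D) (Units.mk0 (sqrtD D) (sqrtD_ne_zero D)) *
        Units.mk0 Q.ideal Q.ideal_ne_zero)

/-- The larger root `ω` of `a x² + b x + c`. -/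
def root (Q : QForm D) : ℝ := -(Q.b : ℝ) / (2 * Q.a) + √(D : ℝ) / (2 * |(Q.a : ℝ)|)

/-- The smaller root `ω*` of `a x² + b x + c`. -/
def conjRoot (Q : QForm D) : ℝ := -(Q.b : ℝ) / (2 * Q.a) - √(D : ℝ) / (2 * |(Q.a : ℝ)|)

theorem conjRoot_lt_root [hD : PosFundDisc D] (Q : QForm D) : Q.conjRoot < Q.root := by
  have h1 : (0 : ℝ) < D := by exact_mod_cast hD.pos
  have h2 : (Q.a : ℝ) ≠ 0 := by exact_mod_cast Q.a_ne_zero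
  have h3 : 0 < √(D : ℝ) / (2 * |(Q.a : ℝ)|) :=
    div_pos (Real.sqrt_pos.2 h1) (mul_pos two_pos (abs_pos.2 h2))
  unfold conjRoot root
  linarith

/-- The matrix `κ = (ω - ω*)^{-1/2} (1, -ω; 1, -ω*)`, which sends `ω` to `0` and `ω*` to `∞`. -/
def kappa [PosFundDisc D] (Q : QForm D) : SL(2, ℝ) :=
  ⟨(√(Q.root - Q.conjRoot))⁻¹ • !![1, -Q.root; 1, -Q.conjRoot], by
    have h : 0 < Q.root - Q.conjRoot := sub_pos.2 Q.conjRoot_lt_root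
    rw [Matrix.det_smul, Matrix.det_fin_two_of, Fintype.card_fin, inv_pow, Real.sq_sqrt h.le]
    field_simp
    ring⟩

/-- The hyperbolic geodesic of `ℍ` joining the roots of `Q`. -/
def geodesic (Q : QForm D) : Set ℍ :=
  {z | (Q.a : ℝ) * Complex.normSq z + Q.b * z.re + Q.c = 0}

/-- The point `κ⁻¹ · i y` of `ℍ`. -/
def liftPoint [PosFundDisc D] (Q : QForm D) (y : ℝ) (hy : 0 < y) : ℍ :=
  Q.kappa⁻¹ • UpperHalfPlane.mk (Complex.I * y) (by simpa using hy)

theorem root_eq [hD : PosFundDisc D] (Q : QForm D) :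
    (Q.a : ℝ) * Q.root ^ 2 + Q.b * Q.root + Q.c = 0 ∧
      (Q.a : ℝ) * Q.conjRoot ^ 2 + Q.b * Q.conjRoot + Q.c = 0 := by
  have h1 : (0 : ℝ) ≤ D := by exact_mod_cast hD.pos.le
  have h2 : (Q.a : ℝ) ≠ 0 := by exact_mod_cast Q.a_ne_zero
  have h3 : |(Q.a : ℝ)| ≠ 0 := abs_ne_zero.2 h2
  have hs : √(D : ℝ) ^ 2 = (Q.b : ℝ) ^ 2 - 4 * Q.a * Q.c := by
    rw [Real.sq_sqrt h1]; exact_mod_cast Q.disc.symm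
  have key : ∀ s : ℝ, s ^ 2 = (Q.b : ℝ) ^ 2 - 4 * Q.a * Q.c →
      (Q.a : ℝ) * ((-Q.b + s) / (2 * Q.a)) ^ 2 + Q.b * ((-Q.b + s) / (2 * Q.a)) + Q.c = 0 := by
    intro s h
    field_simp
    linear_combination h
  unfold root conjRoot
  rcases abs_choice (Q.a : ℝ) with h | h <;> rw [h]
  · refine ⟨?_, ?_⟩
    · rw [← key _ hs]; ring
    · rw [← key (-√(D : ℝ)) (by rw [neg_sq]; exact hs)]; ring
  · refine ⟨?_, ?_⟩
    · rw [← key (-√(D : ℝ)) (by rw [neg_sq]; exact hs), mul_neg, div_neg]; ring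
    · rw [← key _ hs, mul_neg, div_neg]; ring

theorem liftPoint_mem [PosFundDisc D] (Q : QForm D) (y : ℝ) (hy : 0 < y) :
    Q.liftPoint y hy ∈ Q.geodesic := by
  obtain ⟨h1, h2⟩ := Q.root_eq
  have hpos : 0 < Q.root - Q.conjRoot := sub_pos.2 Q.conjRoot_lt_root
  have hr : (√(Q.root - Q.conjRoot))⁻¹ ≠ 0 := inv_ne_zero (Real.sqrt_pos.2 hpos).ne'
  have hN : (1 : ℝ) + y ^ 2 ≠ 0 := by positivity
  have hk : (Q.kappa⁻¹ : SL(2, ℝ)).1 =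
      (√(Q.root - Q.conjRoot))⁻¹ • !![-Q.conjRoot, Q.root; -1, 1] := by
    rw [Matrix.SpecialLinearGroup.coe_inv]
    simp [kappa, Matrix.adjugate_fin_two]
  have hz : ((Q.liftPoint y hy : ℍ) : ℂ) =
      (⟨(Q.root + Q.conjRoot * y ^ 2) / (1 + y ^ 2),
        (Q.root - Q.conjRoot) * y / (1 + y ^ 2)⟩ : ℂ) := by
    have hd : (-(Complex.I * y) + 1 : ℂ) ≠ 0 := by
      intro h
      have := congrArg Complex.re h
      simp at this
    have hr' : (((√(Q.root - Q.conjRoot))⁻¹ : ℝ) : ℂ) ≠ 0 := by exact_mod_cast hr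
    have e1 : ((Q.liftPoint y hy : ℍ) : ℂ) =
        (-Q.conjRoot * (Complex.I * y) + Q.root) / (-(Complex.I * y) + 1) := by
      rw [liftPoint, UpperHalfPlane.coe_specialLinearGroup_apply]
      refine Eq.trans ?_ (mul_div_mul_left _ _ hr')
      simp [hk]
      ring
    rw [e1, div_eq_iff hd]
    apply Complex.ext
    · simp
      field_simp
      ring
    · simp
      field_simp
      ring
  change (Q.a : ℝ) * Complex.normSq ((Q.liftPoint y hy : ℍ) : ℂ) +
    Q.b * ((Q.liftPoint y hy : ℍ) : ℂ).re + Q.c = 0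
  rw [hz, Complex.normSq_mk]
  field_simp
  linear_combination (1 + y ^ 2) * h1 + y ^ 2 * (1 + y ^ 2) * h2

end QForm

/-! ### The union of closed geodesics -/

/-- A form of discriminant `D` together with a point on its geodesic. -/
def MarkedPoint (D : ℤ) : Type := {p : QForm D × ℍ // p.2 ∈ p.1.geodesic}

instance instMeasurableSpaceMarkedPoint (D : ℤ) : MeasurableSpace (MarkedPoint D) :=
  inferInstanceAs (MeasurableSpace {p : QForm D × ℍ // p.2 ∈ p.1.geodesic})

/-- Proper equivalence of forms: being in the same `SL(2, ℤ)`-orbit. -/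
instance formSetoid (D : ℤ) : Setoid (QForm D) where
  r Q Q' := ∃ A : SL(2, ℤ), Q.IsTranslate Q' A
  iseqv :=
    { refl := fun Q => ⟨1, Q.isTranslate_one⟩
      symm := fun ⟨A, h⟩ => ⟨A⁻¹, h.inv⟩
      trans := fun ⟨A, h⟩ ⟨B, h'⟩ => ⟨A * B, h.mul h'⟩ }

/-- The diagonal action of `SL(2, ℤ)`: `(Q, A z)` is identified with `(Q.A, z)`. -/
instance markedSetoid (D : ℤ) : Setoid (MarkedPoint D) where
  r p q := ∃ A : SL(2, ℤ), p.1.1.IsTranslate q.1.1 A ∧ p.1.2 = A • q.1.2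
  iseqv :=
    { refl := fun p => ⟨1, p.1.1.isTranslate_one, (one_smul _ _).symm⟩
      symm := fun ⟨A, h, e⟩ => ⟨A⁻¹, h.inv, by rw [e, inv_smul_smul]⟩
      trans := fun ⟨A, h, e⟩ ⟨B, h', e'⟩ => ⟨A * B, h.mul h', by rw [e, e', mul_smul]⟩ }

/-- The classes of forms of discriminant `D`; each of them is one closed geodesic of
`SL(2, ℤ) \ ℍ`. -/
def FormClass (D : ℤ) : Type := Quotient (formSetoid D)

/-- The union `𝒞_D` of the closed geodesics of `SL(2, ℤ) \ ℍ` of discriminant `D`, each of them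
being the quotient of the geodesic of a form by the stabilizer of that form. The closed geodesics
of distinct classes of forms are kept apart and each is a closed curve (so that points are counted
with multiplicity). -/
def GeodesicUnion (D : ℤ) : Type := Quotient (markedSetoid D)

instance instMeasurableSpaceGeodesicUnion (D : ℤ) : MeasurableSpace (GeodesicUnion D) :=
  inferInstanceAs (MeasurableSpace (Quotient (markedSetoid D)))

/-- The projection of `𝒞_D` to the modular surface `SL(2, ℤ) \ ℍ`. -/
def GeodesicUnion.toModularSurface {D : ℤ} :
    GeodesicUnion D → MulAction.orbitRel.Quotient SL(2, ℤ) ℍ :=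
  Quotient.lift (fun p : MarkedPoint D => Quotient.mk (MulAction.orbitRel SL(2, ℤ) ℍ) p.1.2)
    fun _ _ ⟨A, _, e⟩ => Quotient.sound ⟨A, e.symm⟩

namespace QForm

variable {D : ℤ}

/-- The covering of the closed geodesic of the class of `Q` by the geodesic of `Q`. -/
def proj (Q : QForm D) (z : Q.geodesic) : GeodesicUnion D :=
  Quotient.mk (markedSetoid D) ⟨(Q, z.1), z.2⟩

/-- The arc `κ⁻¹ {i y | 1 ≤ y < ε_D²}`, on which `proj` is a bijection to the closed geodesic. -/
def fundamentalArc [PosFundDisc D] (Q : QForm D) : Set Q.geodesic :=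
  {z | 1 ≤ (Q.kappa • (z : ℍ)).im ∧ (Q.kappa • (z : ℍ)).im < epsilonD D ^ 2}

/-- The hyperbolic arc length measure on the closed geodesic of the class of `Q`, with `μH[1]` the
one-dimensional Hausdorff measure of the hyperbolic metric. -/
def arcLength [PosFundDisc D] (Q : QForm D) : Measure (GeodesicUnion D) :=
  ((μH[1] : Measure Q.geodesic).restrict Q.fundamentalArc).map Q.proj

/-- The values `g (κ⁻¹ · i y)` for `y > 0`. -/
def along [PosFundDisc D] (Q : QForm D) (g : GeodesicUnion D → ℂ) (y : ℝ) : ℂ :=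
  if hy : 0 < y then g (Q.proj ⟨Q.liftPoint y hy, Q.liftPoint_mem y hy⟩) else 0

end QForm

/-- The arc length measure `ds` on `𝒞_D`: the sum of the arc length measures of its closed
geodesics. -/
def arcLength (D : ℤ) [PosFundDisc D] : Measure (GeodesicUnion D) :=
  Measure.sum fun C : FormClass D => (Quotient.out C).arcLength

/-- The length `|𝒞_D|`. -/
def totalLength (D : ℤ) [PosFundDisc D] : ℝ := (arcLength D).real Set.univ

/-- The integrand `g (κ⁻¹ · i y) y ^ (-n π i / log ε_D) / y`. -/
def twistedIntegrand {D : ℤ} [PosFundDisc D] (Q : QForm D) (g : GeodesicUnion D → ℂ) (n : ℤ)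
    (y : ℝ) : ℂ :=
  Q.along g y * (y : ℂ) ^ (-(n * Real.pi * Complex.I) / (Real.log (epsilonD D) : ℂ)) / y

/-- `I(g, χ_{ψ,n})`, computed with the lift of the closed geodesic of each ideal class `𝔞` that is
given by the form `Q 𝔞`. -/
def periodSq {D : ℤ} [PosFundDisc D] (Q : NarrowClassGroup D → QForm D)
    (g : GeodesicUnion D → ℂ) (ψ : NarrowClassGroup D →* ℂˣ) (n : ℤ) : ℝ :=
  ‖∑ 𝔞 : NarrowClassGroup D, (((ψ 𝔞)⁻¹ : ℂˣ) : ℂ) *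
    ∫ y in (1 : ℝ)..epsilonD D ^ 2, twistedIntegrand (Q 𝔞) g n y‖ ^ 2

end RestrictionNorm

end

/-!
The formula is Plancherel's theorem for the compact abelian group `H⁺ × ℝ / (log ε_D²) ℤ`, once
`𝒞_D` is recognized as a disjoint union of circles of length `L = log ε_D²` indexed by `H⁺`.

The map from forms to narrow ideal classes induces a bijection from the `SL(2, ℤ)`-classes of forms
(`bijective_formClass`). With the form `Q` goes the linear form `a x + (b - √D) / 2 · y`, which has
norm `a · Q(x, y)` and whose values are the ideal of `Q`. A proper equivalence of forms is the same
as a factor between the two ideals whose norm has the sign of `a a'`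
(`QForm.idealClass_eq_of_isTranslate`, `QForm.exists_isTranslate_of_idealClass_eq`), and every ideal
has a basis of the required kind up to a positive integer (`exists_form_of_ideal`).

For a form `Q`, the map `t ↦ κ⁻¹ · i eᵗ` is an isometry from `ℝ` to the geodesic of `Q`
(`QForm.param`). The unit `ε_D` yields an automorph of `Q` that shifts the parameter by `L`
(`QForm.curve_periodic`), and an equivalence of two forms is an isometry between their geodesics, so
it changes the parameter by a shift or a reflection. Therefore the arc length measure on the closed
geodesic is the image of Lebesgue measure on `(0, L]`, for any form of the class
(`QForm.arcLength_eq_map`, `QForm.IsTranslate.arcLength_eq`), and `ds` is the sum of these measures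
over the chosen forms (`arcLength_eq_sum`).

The substitution `y = eᵗ` turns the inner integral of `I(g, χ_{ψ,n})` into `L` times the `n`-th
Fourier coefficient of `t ↦ g (κ⁻¹ · i eᵗ)` (`integral_twistedIntegrand`). Summing over `ψ` by orthogonality
of characters gives a factor `|H⁺|`, and summing over `n` by Parseval's identity gives a factor `L`.
Their product is `|𝒞_D|` (`totalLength_eq`).
-/

namespace RestrictionNorm

variable {D : ℤ}

/-! ### The arithmetic of `ℚ(√D)` -/

theorem sqrtD_sq [hD : PosFundDisc D] : sqrtD D ^ 2 = (D : QField D) := by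
  apply Subtype.ext
  have h : (0 : ℝ) ≤ D := by exact_mod_cast hD.pos.le
  change √(D : ℝ) ^ 2 = (D : ℝ)
  exact Real.sq_sqrt h

theorem irrational_sqrt_disc [hD : PosFundDisc D] : Irrational √(D : ℝ) := by
  rw [irrational_sqrt_intCast_iff]
  refine ⟨fun ⟨b, hb⟩ => not_sq_of_fundamental hD.fundamental b hb.symm, hD.pos.le⟩

theorem exists_rat_coords [PosFundDisc D] (x : QField D) :
    ∃ r s : ℚ, x = r + s * sqrtD D := by
  obtain ⟨x, hx⟩ := x
  have hx' : x ∈ Algebra.adjoin ℚ {√(D : ℝ)} := by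
    rw [← IntermediateField.adjoin_simple_toSubalgebra_of_isAlgebraic
      (isIntegral_sqrt D).isAlgebraic]
    exact hx
  have h2 : √(D : ℝ) ^ 2 = D := congrArg Subtype.val (sqrtD_sq (D := D))
  suffices h : ∃ r s : ℚ, x = r + s * √(D : ℝ) by
    obtain ⟨r, s, h⟩ := h
    exact ⟨r, s, Subtype.ext h⟩
  clear hx
  induction hx' using Algebra.adjoin_induction with
  | mem x hx => exact ⟨0, 1, by simpa using hx⟩
  | algebraMap r => exact ⟨r, 0, by simp⟩
  | add x y _ _ ihx ihy =>
    obtain ⟨r, s, rfl⟩ := ihx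
    obtain ⟨r', s', rfl⟩ := ihy
    exact ⟨r + r', s + s', by push_cast; ring⟩
  | mul x y _ _ ihx ihy =>
    obtain ⟨r, s, rfl⟩ := ihx
    obtain ⟨r', s', rfl⟩ := ihy
    exact ⟨r * r' + s * s' * D, r * s' + s * r', by
      push_cast; linear_combination (s * s' : ℝ) * h2⟩

theorem rat_coords_eq_zero [PosFundDisc D] {r s : ℚ}
    (h : (r : QField D) + s * sqrtD D = 0) : r = 0 ∧ s = 0 := by
  have h' : (r : ℝ) + s * √(D : ℝ) = 0 := congrArg Subtype.val h
  have hs : s = 0 := by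
    by_contra hs
    refine irrational_sqrt_disc (D := D) ⟨-r / s, ?_⟩
    have : (s : ℝ) ≠ 0 := by exact_mod_cast hs
    push_cast
    field_simp
    linarith
  subst hs
  simpa using h'

theorem rat_coords_inj [PosFundDisc D] {r s r' s' : ℚ}
    (h : (r : QField D) + s * sqrtD D = r' + s' * sqrtD D) : r = r' ∧ s = s' := by
  have := rat_coords_eq_zero (D := D) (r := r - r') (s := s - s') (by
    push_cast; linear_combination h)
  exact ⟨sub_eq_zero.1 this.1, sub_eq_zero.1 this.2⟩

theorem exists_conj [PosFundDisc D] :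
    ∃ σ : QField D →+* QField D, σ (sqrtD D) = -sqrtD D := by
  choose r s h using exists_rat_coords (D := D)
  have hq := sqrtD_sq (D := D)
  have key : ∀ (x : QField D) (p q : ℚ), x = p + q * sqrtD D → r x = p ∧ s x = q :=
    fun x p q e => rat_coords_inj ((h x).symm.trans e)
  have hadd : ∀ x y, r (x + y) = r x + r y ∧ s (x + y) = s x + s y := fun x y => key _ _ _ <| by
    calc x + y = (r x + s x * sqrtD D) + (r y + s y * sqrtD D) := by rw [← h x, ← h y]
      _ = _ := by push_cast; ring
  have hmul : ∀ x y, r (x * y) = r x * r y + s x * s y * D ∧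
      s (x * y) = r x * s y + s x * r y := fun x y => key _ _ _ <| by
    calc x * y = (r x + s x * sqrtD D) * (r y + s y * sqrtD D) := by rw [← h x, ← h y]
      _ = r x * r y + s x * s y * sqrtD D ^ 2 + (r x * s y + s x * r y) * sqrtD D := by ring
      _ = _ := by rw [hq]; push_cast; ring
  let f : QField D → QField D := fun x => r x - s x * sqrtD D
  have f1 : f 1 = 1 := by
    obtain ⟨h1, h2⟩ := key 1 1 0 (by simp)
    simp only [f, h1, h2]
    simp
  have f0 : f 0 = 0 := by
    obtain ⟨h1, h2⟩ := key 0 0 0 (by simp)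
    simp only [f, h1, h2]
    simp
  have fm : ∀ x y, f (x * y) = f x * f y := fun x y => by
    simp only [f, hmul]
    push_cast
    rw [← hq]
    ring
  have fa : ∀ x y, f (x + y) = f x + f y := fun x y => by
    simp only [f, hadd]
    push_cast
    ring
  refine ⟨{ toFun := f, map_one' := f1, map_mul' := fm, map_zero' := f0, map_add' := fa }, ?_⟩
  obtain ⟨h1, h2⟩ := key (sqrtD D) 0 1 (by simp)
  change f (sqrtD D) = _
  simp only [f, h1, h2]
  simp

/-- The nontrivial automorphism of `ℚ(√D)`. -/
noncomputable def conj (D : ℤ) [PosFundDisc D] : QField D →+* QField D :=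
  (exists_conj (D := D)).choose

@[simp] theorem conj_sqrtD [PosFundDisc D] : conj D (sqrtD D) = -sqrtD D :=
  (exists_conj (D := D)).choose_spec

/-- The norm `x · x'` of `ℚ(√D)`, as a real number. -/
noncomputable def nrm [PosFundDisc D] (x : QField D) : ℝ := ((x * conj D x : QField D) : ℝ)

theorem nrm_mul [PosFundDisc D] (x y : QField D) : nrm (x * y) = nrm x * nrm y := by
  simp only [nrm, map_mul]
  push_cast
  ring

theorem nrm_sqrtD [PosFundDisc D] : nrm (sqrtD D) = -D := by
  have h : sqrtD D * conj D (sqrtD D) = ((-D : ℤ) : QField D) := by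
    rw [conj_sqrtD]; push_cast; linear_combination -sqrtD_sq (D := D)
  rw [nrm, h]; simp

theorem nrm_ne_zero [PosFundDisc D] {x : QField D} (hx : x ≠ 0) : nrm x ≠ 0 := by
  have : x * conj D x ≠ 0 := mul_ne_zero hx ((map_ne_zero _).2 hx)
  simpa [nrm] using this

/-- The real embeddings of `ℚ(√D)` are the inclusion and its conjugate. -/
theorem ringHom_eq [hD : PosFundDisc D] (σ : QField D →+* ℝ) :
    (∀ x, σ x = x) ∨ (∀ x, σ x = (conj D x : QField D)) := by
  have h : σ (sqrtD D) ^ 2 = D := by rw [← map_pow, sqrtD_sq]; simp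
  have h' : √(D : ℝ) ^ 2 = D := Real.sq_sqrt (by exact_mod_cast hD.pos.le)
  rcases sq_eq_sq_iff_eq_or_eq_neg.1 (h.trans h'.symm) with h | h
  · left; intro x
    obtain ⟨r, s, rfl⟩ := exists_rat_coords x
    simp only [map_add, map_mul, map_ratCast, h]; simp; left; rfl
  · right; intro x
    obtain ⟨r, s, rfl⟩ := exists_rat_coords x
    simp only [map_add, map_mul, map_ratCast, conj_sqrtD, h]; simp; left; rfl

/-- Total positivity is expressed through one embedding and the norm. -/
theorem mem_totallyPositive [PosFundDisc D] {x : (QField D)ˣ} :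
    x ∈ totallyPositive D ↔ 0 < ((x : QField D) : ℝ) ∧ 0 < nrm (x : QField D) := by
  have e : nrm (x : QField D) = ((x : QField D) : ℝ) * (conj D (x : QField D) : QField D) := by
    simp [nrm]
  constructor
  · intro h
    have h1 : 0 < ((x : QField D) : ℝ) := h (QField D).val.toRingHom
    have h2 : 0 < ((conj D (x : QField D) : QField D) : ℝ) :=
      h ((QField D).val.toRingHom.comp (conj D))
    exact ⟨h1, e ▸ mul_pos h1 h2⟩
  · rintro ⟨h1, h2⟩ σ
    rw [e] at h2
    rcases ringHom_eq σ with h | h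
    · rw [h]; exact h1
    · rw [h]; exact (pos_iff_pos_of_mul_pos h2).1 h1

/-- The integers of `ℚ(√D)` are the `(t + u √D) / 2` with `t, u ∈ ℤ` and `t² - D u² ∈ 4 ℤ`. For
the direct implication, the trace `t` and the norm are rational integers, hence so is `D u²`, and
`u` is an integer because `D` or `D / 4` is squarefree. -/
theorem isIntegral_iff [hD : PosFundDisc D] {x : QField D} :
    IsIntegral ℤ x ↔ ∃ t u : ℤ, x = (t + u * sqrtD D) / 2 ∧ 4 ∣ t ^ 2 - D * u ^ 2 := by
  have hq := sqrtD_sq (D := D)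
  constructor
  · intro hx
    have hc : IsIntegral ℤ (conj D x) := hx.map (conj D).toIntAlgHom
    obtain ⟨r, s, rfl⟩ := exists_rat_coords x
    have ratInt : ∀ q : ℚ, IsIntegral ℤ (q : QField D) → ∃ n : ℤ, q = n := by
      intro q hq
      have : IsIntegral ℤ q :=
        (isIntegral_algebraMap_iff (algebraMap ℚ (QField D)).injective).1 (by simpa using hq)
      obtain ⟨n, hn⟩ := IsIntegrallyClosed.isIntegral_iff.1 this
      exact ⟨n, by simpa using hn.symm⟩
    obtain ⟨t, ht⟩ := ratInt (2 * r) (by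
      have := hx.add hc
      simp only [map_add, map_mul, map_ratCast, conj_sqrtD] at this
      rwa [show ((r : QField D) + s * sqrtD D) + (r + s * -sqrtD D) = ((2 * r : ℚ) : QField D) by
        push_cast; ring] at this)
    obtain ⟨n, hn⟩ := ratInt (r ^ 2 - D * s ^ 2) (by
      have := hx.mul hc
      simp only [map_add, map_mul, map_ratCast, conj_sqrtD] at this
      rwa [show ((r : QField D) + s * sqrtD D) * (r + s * -sqrtD D) =
        ((r ^ 2 - D * s ^ 2 : ℚ) : QField D) by push_cast; rw [← hq]; ring] at this)
    have hk : (D : ℚ) * (2 * s) ^ 2 = (t ^ 2 - 4 * n : ℤ) := by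
      push_cast; rw [← ht, ← hn]; ring
    -- a rational number whose square times a squarefree integer is integral is an integer
    have sqf : ∀ (m k : ℤ) (v : ℚ), Squarefree m → (m : ℚ) * v ^ 2 = k → ∃ w : ℤ, v = w := by
      intro m k v hm hv
      have hd : (v.den : ℚ) ≠ 0 := by exact_mod_cast v.den_nz
      have h1 : m * v.num ^ 2 = k * (v.den : ℤ) ^ 2 := by
        have : (m : ℚ) * (v.num) ^ 2 = k * (v.den) ^ 2 := by
          rw [← hv]; nth_rewrite 2 [← Rat.num_div_den v]; field_simp
        exact_mod_cast this
      have hco : IsCoprime ((v.den : ℤ) ^ 2) (v.num ^ 2) := by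
        refine IsCoprime.pow ?_
        rw [Int.isCoprime_iff_gcd_eq_one, Int.gcd_comm]
        exact v.reduced
      have h2 : (v.den : ℤ) ^ 2 ∣ m := hco.dvd_of_dvd_mul_right ⟨k, by rw [h1]; ring⟩
      have h3 := hm (v.den : ℤ) (by rw [← sq]; exact h2)
      have h4 : v.den = 1 := by simpa using Int.isUnit_iff_natAbs_eq.1 h3
      exact ⟨v.num, by rw [Rat.coe_int_num_of_den_eq_one h4]⟩
    obtain ⟨u, hu⟩ : ∃ u : ℤ, 2 * s = u := by
      rcases hD.fundamental with ⟨-, h, -⟩ | ⟨h4, hm, h⟩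
      · exact sqf D _ _ h hk
      · obtain ⟨m, rfl⟩ := Int.dvd_of_emod_eq_zero h4
        simp only [ne_eq, OfNat.ofNat_ne_zero, not_false_eq_true, Int.mul_ediv_cancel_left] at hm h
        obtain ⟨v, hv⟩ := sqf m (t ^ 2 - 4 * n) (4 * s) h (by rw [← hk]; push_cast; ring)
        have h5 : m * v ^ 2 = t ^ 2 - 4 * n := by
          have : (m : ℚ) * v ^ 2 = (t ^ 2 - 4 * n : ℤ) := by rw [← hk, ← hv]; push_cast; ring
          exact_mod_cast this
        obtain ⟨w, hw | hw⟩ := Int.even_or_odd' v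
        · exact ⟨w, by rw [hw] at hv; push_cast at hv; linarith⟩
        -- for odd `v` the number `m` would be a square modulo `4`
        · exfalso
          have h6 : m = t ^ 2 - 4 * (n + m * w ^ 2 + m * w) := by rw [hw] at h5; linarith
          obtain ⟨z, hz | hz⟩ := Int.even_or_odd' t
          · have : m = 4 * (z ^ 2 - (n + m * w ^ 2 + m * w)) := by rw [hz] at h6; linarith
            omega
          · have : m = 4 * (z ^ 2 + z - (n + m * w ^ 2 + m * w)) + 1 := by
              rw [hz] at h6; linarith
            omega
    refine ⟨t, u, ?_, n, ?_⟩
    · have h1 : (t : QField D) = 2 * r := by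
        have := congrArg (Rat.cast : ℚ → QField D) ht; push_cast at this; exact this.symm
      have h2 : (u : QField D) = 2 * s := by
        have := congrArg (Rat.cast : ℚ → QField D) hu; push_cast at this; exact this.symm
      rw [h1, h2]; ring
    · have : (t ^ 2 - D * u ^ 2 : ℚ) = 4 * n := by rw [← ht, ← hu, ← hn]; ring
      exact_mod_cast this
  · rintro ⟨t, u, rfl, n, hn⟩
    have hn' : (t : QField D) ^ 2 - D * u ^ 2 = 4 * n := by exact_mod_cast hn
    have h0 : ((t + u * sqrtD D) / 2 : QField D) ^ 2 - t * ((t + u * sqrtD D) / 2) + n = 0 := by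
      linear_combination (u ^ 2 / 4 : QField D) * hq - hn' / 4
    refine ⟨Polynomial.X ^ 2 - Polynomial.C t * Polynomial.X + Polynomial.C n, by monicity!, ?_⟩
    rw [← h0]
    simp only [Polynomial.eval₂_add, Polynomial.eval₂_sub, Polynomial.eval₂_mul,
      Polynomial.eval₂_pow, Polynomial.eval₂_X, Polynomial.eval₂_C]
    simp

/-! ### The totally positive units -/

theorem nrm_half [PosFundDisc D] (t u : ℤ) :
    nrm ((t + u * sqrtD D) / 2 : QField D) = (t ^ 2 - D * u ^ 2) / 4 := by
  have h : ((t + u * sqrtD D) / 2 : QField D) * conj D ((t + u * sqrtD D) / 2) =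
      (t ^ 2 - D * u ^ 2) / 4 := by
    simp only [map_div₀, map_add, map_mul, map_intCast, conj_sqrtD, map_ofNat]
    linear_combination -(u ^ 2 / 4 : QField D) * sqrtD_sq (D := D)
  rw [nrm, h]
  push_cast
  rfl

theorem nrm_one [PosFundDisc D] : nrm (1 : QField D) = 1 := by simp [nrm]

theorem exists_int_nrm [PosFundDisc D] (x : 𝓞 (QField D)) :
    ∃ n : ℤ, nrm (x : QField D) = n := by
  obtain ⟨t, u, h, n, hn⟩ := isIntegral_iff.1 x.2
  have hn' : (t ^ 2 - D * u ^ 2 : ℝ) = 4 * n := by exact_mod_cast hn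
  exact ⟨n, (congrArg nrm h).trans (by rw [nrm_half, hn']; ring)⟩

/-- A totally positive unit is `(t + s √D) / 2` for a solution of the Pell equation
`t² - D s² = 4`. -/
theorem exists_pell_of_mem [PosFundDisc D] {v : (𝓞 (QField D))ˣ}
    (hv : v ∈ totallyPositiveUnits D) :
    ∃ t s : ℤ, (((v : 𝓞 (QField D)) : QField D) : ℝ) = (t + s * √(D : ℝ)) / 2 ∧
      t ^ 2 - D * s ^ 2 = 4 := by
  have hpos : 0 < nrm ((v : 𝓞 (QField D)) : QField D) := (mem_totallyPositive.1 hv).2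
  obtain ⟨n, hn⟩ := exists_int_nrm (v : 𝓞 (QField D))
  obtain ⟨m, hm⟩ := exists_int_nrm ((v⁻¹ : (𝓞 (QField D))ˣ) : 𝓞 (QField D))
  have hnm : n * m = 1 := by
    have : nrm ((v : 𝓞 (QField D)) : QField D) *
        nrm (((v⁻¹ : (𝓞 (QField D))ˣ) : 𝓞 (QField D)) : QField D) = 1 := by
      rw [← nrm_mul, ← map_mul, Units.mul_inv, map_one, nrm_one]
    rw [hn, hm] at this
    exact_mod_cast this
  have hn0 : 0 < n := by rw [hn] at hpos; exact_mod_cast hpos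
  have hn1 : n = 1 := (Int.eq_one_or_neg_one_of_mul_eq_one hnm).resolve_right (by omega)
  obtain ⟨t, s, h, -⟩ := isIntegral_iff.1 (v : 𝓞 (QField D)).2
  refine ⟨t, s, ?_, ?_⟩
  · exact congrArg Subtype.val h
  · have e : nrm ((v : 𝓞 (QField D)) : QField D) = (t ^ 2 - D * s ^ 2) / 4 :=
      (congrArg nrm h).trans (nrm_half t s)
    rw [hn, hn1] at e
    have : (t ^ 2 - D * s ^ 2 : ℝ) = 4 := by push_cast at e; linarith
    exact_mod_cast this

/-- The trace of a totally positive unit different from `1` is at least `3`, so such a unit is not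
close to `1`. -/
theorem two_le_of_mem [PosFundDisc D] {v : (𝓞 (QField D))ˣ}
    (hv : v ∈ totallyPositiveUnits D) (h1 : 1 < (((v : 𝓞 (QField D)) : QField D) : ℝ)) :
    2 ≤ (((v : 𝓞 (QField D)) : QField D) : ℝ) := by
  obtain ⟨t, s, h, hp⟩ := exists_pell_of_mem hv
  set x := (((v : 𝓞 (QField D)) : QField D) : ℝ)
  have hD : √(D : ℝ) ^ 2 = D := congrArg Subtype.val (sqrtD_sq (D := D))
  have hp' : (t ^ 2 - D * s ^ 2 : ℝ) = 4 := by exact_mod_cast hp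
  have e : x ^ 2 + 1 = t * x := by rw [h]; linear_combination (s ^ 2 / 4 : ℝ) * hD - hp' / 4
  have ht : (2 : ℝ) < t := by nlinarith
  have ht' : (3 : ℝ) ≤ t := by exact_mod_cast (show (2 : ℤ) < t by exact_mod_cast ht)
  nlinarith

/-- Pell's equation provides a nontrivial totally positive unit. -/
theorem exists_one_lt_mem [hD : PosFundDisc D] : ∃ v ∈ totallyPositiveUnits D,
    1 < (((v : 𝓞 (QField D)) : QField D) : ℝ) := by
  have hns : ¬ IsSquare D := fun ⟨b, hb⟩ => not_sq_of_fundamental hD.fundamental b hb.symm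
  obtain ⟨x, y, hxy, hx1, hy1⟩ : ∃ x y : ℤ, x ^ 2 - D * y ^ 2 = 1 ∧ 1 ≤ x ∧ 1 ≤ y := by
    obtain ⟨x, y, hxy, hy⟩ := Pell.exists_of_not_isSquare hD.pos hns
    refine ⟨|x|, |y|, by rw [sq_abs, sq_abs]; exact hxy, Int.one_le_abs ?_, Int.one_le_abs hy⟩
    rintro rfl
    have h1 : 0 < D * y ^ 2 := mul_pos hD.pos (by positivity)
    linarith
  have hq := sqrtD_sq (D := D)
  have hint : ∀ u : ℤ, u ^ 2 = y ^ 2 →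
      IsIntegral ℤ (((2 * x : ℤ) + (2 * u : ℤ) * sqrtD D) / 2 : QField D) := fun u hu =>
    isIntegral_iff.2 ⟨_, _, rfl, 1, by rw [mul_pow, mul_pow, hu]; linarith⟩
  have hx : (x : QField D) ^ 2 - sqrtD D ^ 2 * y ^ 2 = 1 := by
    rw [hq]; exact_mod_cast hxy
  let v : (𝓞 (QField D))ˣ :=
    { val := ⟨_, hint y rfl⟩
      inv := ⟨_, hint (-y) (neg_sq y)⟩
      val_inv := Subtype.ext (by
        change (((2 * x : ℤ) + (2 * y : ℤ) * sqrtD D) / 2 : QField D) *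
          (((2 * x : ℤ) + (2 * -y : ℤ) * sqrtD D) / 2) = 1
        push_cast
        linear_combination hx)
      inv_val := Subtype.ext (by
        change (((2 * x : ℤ) + (2 * -y : ℤ) * sqrtD D) / 2 : QField D) *
          (((2 * x : ℤ) + (2 * y : ℤ) * sqrtD D) / 2) = 1
        push_cast
        linear_combination hx) }
  have hval : (((v : 𝓞 (QField D)) : QField D) : ℝ) = x + y * √(D : ℝ) := by
    change (((2 * x : ℤ) + (2 * y : ℤ) * √(D : ℝ)) / 2 : ℝ) = _
    push_cast; ring
  have h1 : 1 < (((v : 𝓞 (QField D)) : QField D) : ℝ) := by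
    have hx1 : (1 : ℝ) ≤ x := by exact_mod_cast hx1
    have hy1 : (0 : ℝ) < y := by exact_mod_cast hy1
    have hs : 0 < √(D : ℝ) := Real.sqrt_pos.2 (by exact_mod_cast hD.pos)
    rw [hval]
    linarith [mul_pos hy1 hs]
  refine ⟨v, ?_, h1⟩
  refine (mem_totallyPositive (x := Units.map _ v)).2 ⟨zero_lt_one.trans h1, ?_⟩
  change 0 < nrm (((2 * x : ℤ) + (2 * y : ℤ) * sqrtD D) / 2 : QField D)
  rw [nrm_half]
  have : ((2 * x : ℤ) ^ 2 - D * (2 * y : ℤ) ^ 2 : ℝ) = 4 := by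
    have : (2 * x) ^ 2 - D * (2 * y) ^ 2 = 4 := by linarith
    exact_mod_cast this
  rw [this]; norm_num

theorem totallyPositiveUnits_pos [PosFundDisc D] {v : (𝓞 (QField D))ˣ}
    (hv : v ∈ totallyPositiveUnits D) : 0 < (((v : 𝓞 (QField D)) : QField D) : ℝ) :=
  (mem_totallyPositive.1 hv).1

/-- The logarithms of the totally positive units. -/
def logUnits (D : ℤ) [PosFundDisc D] : AddSubgroup ℝ where
  carrier := {r | ∃ v ∈ totallyPositiveUnits D,
    (((v : 𝓞 (QField D)) : QField D) : ℝ) = Real.exp r}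
  zero_mem' := ⟨1, one_mem _, by simp⟩
  add_mem' := by
    rintro a b ⟨v, hv, ha⟩ ⟨w, hw, hb⟩
    exact ⟨v * w, mul_mem hv hw, by simp [Real.exp_add, ← ha, ← hb]⟩
  neg_mem' := by
    rintro a ⟨v, hv, ha⟩
    refine ⟨v⁻¹, inv_mem hv, ?_⟩
    have : (((v⁻¹ : (𝓞 (QField D))ˣ) : 𝓞 (QField D)) : QField D) *
        ((v : 𝓞 (QField D)) : QField D) = 1 := by
      rw [← map_mul, Units.inv_mul, map_one]
    have h : ((((v⁻¹ : (𝓞 (QField D))ˣ) : 𝓞 (QField D)) : QField D) : ℝ) *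
        (((v : 𝓞 (QField D)) : QField D) : ℝ) = 1 := congrArg Subtype.val this
    rw [Real.exp_neg, ← ha]
    exact eq_inv_of_mul_eq_one_left h

/-- The group of totally positive units is cyclic, because its image under the logarithm is a
discrete subgroup of `ℝ`. Hence the choice in the definition of `ε_D` is not vacuous. -/
theorem exists_generator [PosFundDisc D] : ∃ x : ℝ, 1 < x ∧ ∃ u : (𝓞 (QField D))ˣ,
    ((u : 𝓞 (QField D)) : QField D) = x ∧ Subgroup.zpowers u = totallyPositiveUnits D := by
  obtain ⟨b, hb⟩ : ∃ b, logUnits D = AddSubgroup.closure {b} := by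
    refine AddSubgroup.cyclic_of_isolated_zero (a := Real.log 2) (Real.log_pos one_lt_two) ?_
    rw [Set.disjoint_left]
    rintro r ⟨v, hv, hr⟩ ⟨h0, h2⟩
    have := two_le_of_mem hv (by rw [hr]; exact Real.one_lt_exp_iff.2 h0)
    rw [hr, ← Real.log_le_iff_le_exp two_pos] at this
    exact absurd h2 this.not_gt
  obtain ⟨b, hb0, hb⟩ : ∃ b, 0 < b ∧ logUnits D = AddSubgroup.zmultiples b := by
    rw [← AddSubgroup.zmultiples_eq_closure] at hb
    rcases lt_trichotomy b 0 with h | h | h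
    · exact ⟨-b, by linarith, by rw [hb, AddSubgroup.zmultiples_neg]⟩
    · exfalso
      obtain ⟨v, hv, h1⟩ := exists_one_lt_mem (D := D)
      have hm : Real.log (((v : 𝓞 (QField D)) : QField D) : ℝ) ∈ logUnits D :=
        ⟨v, hv, (Real.exp_log (zero_lt_one.trans h1)).symm⟩
      rw [hb, h, AddSubgroup.zmultiples_zero_eq_bot, AddSubgroup.mem_bot] at hm
      exact (Real.log_pos h1).ne' hm
    · exact ⟨b, h, hb⟩
  obtain ⟨u, hu, hub⟩ : b ∈ logUnits D := by rw [hb]; exact AddSubgroup.mem_zmultiples b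
  refine ⟨Real.exp b, Real.one_lt_exp_iff.2 hb0, u, hub, le_antisymm ?_ fun v hv => ?_⟩
  · rwa [Subgroup.zpowers_le]
  · have hv0 := totallyPositiveUnits_pos hv
    have hm : Real.log (((v : 𝓞 (QField D)) : QField D) : ℝ) ∈ logUnits D :=
      ⟨v, hv, (Real.exp_log hv0).symm⟩
    rw [hb, AddSubgroup.mem_zmultiples_iff] at hm
    obtain ⟨k, hk⟩ := hm
    refine Subgroup.mem_zpowers_iff.2 ⟨k, ?_⟩
    have e : Units.map ((QField D).val.toRingHom.comp
        (algebraMap (𝓞 (QField D)) (QField D))).toMonoidHom (u ^ k) =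
        Units.map ((QField D).val.toRingHom.comp
        (algebraMap (𝓞 (QField D)) (QField D))).toMonoidHom v := by
      rw [map_zpow]
      ext
      rw [Units.val_zpow_eq_zpow_val]
      change (((u : 𝓞 (QField D)) : QField D) : ℝ) ^ k = (((v : 𝓞 (QField D)) : QField D) : ℝ)
      rw [hub, ← Real.exp_log hv0, ← hk, zsmul_eq_mul, mul_comm, Real.exp_mul, Real.rpow_intCast]
    refine Units.ext (Subtype.ext (Subtype.ext ?_))
    exact congrArg Units.val e

theorem one_lt_epsilonD (D : ℤ) [PosFundDisc D] : 1 < epsilonD D :=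
  (Classical.epsilon_spec (exists_generator (D := D))).1

theorem epsilonD_pell (D : ℤ) [PosFundDisc D] :
    ∃ t s : ℤ, epsilonD D = (t + s * √(D : ℝ)) / 2 ∧ t ^ 2 - D * s ^ 2 = 4 := by
  obtain ⟨-, u, hu, hz⟩ := Classical.epsilon_spec (exists_generator (D := D))
  have hm : u ∈ totallyPositiveUnits D := hz ▸ Subgroup.mem_zpowers u
  obtain ⟨t, s, h, hp⟩ := exists_pell_of_mem hm
  exact ⟨t, s, hu.symm.trans h, hp⟩

/-! ### Forms and their ideals -/

/-- Over a fundamental discriminant every integral form is primitive. -/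
theorem primitive_of_disc [hD : PosFundDisc D] {a b c : ℤ} (h : b ^ 2 - 4 * a * c = D) :
    Int.gcd (Int.gcd a b) c = 1 := by
  obtain ⟨g, hg⟩ : ∃ g : ℤ, ((Int.gcd (Int.gcd a b) c : ℕ) : ℤ) = g := ⟨_, rfl⟩
  have hgc : g ∣ c := hg ▸ Int.gcd_dvd_right _ _
  have hgab : g ∣ (Int.gcd a b : ℤ) := hg ▸ Int.gcd_dvd_left _ _
  obtain ⟨a, rfl⟩ := hgab.trans (Int.gcd_dvd_left _ _)
  obtain ⟨b, rfl⟩ := hgab.trans (Int.gcd_dvd_right _ _)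
  obtain ⟨c, rfl⟩ := hgc
  suffices IsUnit g by
    have h1 := Int.isUnit_iff.1 this
    omega
  have hgD : g * g ∣ D := ⟨b ^ 2 - 4 * a * c, by rw [← h]; ring⟩
  rcases hD.fundamental with ⟨-, hs, -⟩ | ⟨h4, hm, hs⟩
  · exact hs g hgD
  · obtain ⟨m, rfl⟩ := Int.dvd_of_emod_eq_zero h4
    simp only [ne_eq, OfNat.ofNat_ne_zero, not_false_eq_true, Int.mul_ediv_cancel_left] at hm hs
    obtain ⟨k, hk | hk⟩ := Int.even_or_odd' g
    · exfalso
      have h5 : m = k * k * (b ^ 2 - 4 * a * c) := by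
        rw [hk] at h; linarith
      have hkk : k * k = 1 := by
        rcases Int.isUnit_iff.1 (hs k ⟨_, h5⟩) with rfl | rfl <;> rfl
      rw [hkk, one_mul] at h5
      obtain ⟨z, hz | hz⟩ := Int.even_or_odd' b
      · have : m = 4 * (z ^ 2 - a * c) := by rw [hz] at h5; linarith
        omega
      · have : m = 4 * (z ^ 2 + z - a * c) + 1 := by rw [hz] at h5; linarith
        omega
    · refine hs g (IsCoprime.dvd_of_dvd_mul_left ?_ hgD)
      exact ⟨1, -(k ^ 2 + k), by rw [hk]; ring⟩

theorem det_eq_one (A : SL(2, ℤ)) : A 0 0 * A 1 1 - A 0 1 * A 1 0 = 1 := by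
  rw [← Matrix.det_fin_two]; exact A.det_coe

theorem toPrincipalIdeal_neg (x : (QField D)ˣ) :
    toPrincipalIdeal (𝓞 (QField D)) (QField D) (-x) =
      toPrincipalIdeal (𝓞 (QField D)) (QField D) x := by
  rw [toPrincipalIdeal_eq_iff, coe_toPrincipalIdeal, Units.val_neg]
  ext z
  simp only [FractionalIdeal.mem_spanSingleton]
  constructor
  · rintro ⟨w, rfl⟩; exact ⟨-w, by simp⟩
  · rintro ⟨w, rfl⟩; exact ⟨-w, by simp⟩

/-- Totally positive generators may be replaced by generators of positive norm, because `-1` is a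
unit. -/
theorem toPrincipalIdeal_mem_narrowPrincipal [PosFundDisc D] {x : (QField D)ˣ}
    (hx : 0 < nrm (x : QField D)) :
    toPrincipalIdeal (𝓞 (QField D)) (QField D) x ∈ narrowPrincipal D := by
  rcases lt_trichotomy ((x : QField D) : ℝ) 0 with h | h | h
  · refine ⟨-x, mem_totallyPositive.2 ⟨?_, ?_⟩, toPrincipalIdeal_neg x⟩
    · simpa using h
    · simpa [nrm] using hx
  · exact absurd (Subtype.ext h : (x : QField D) = 0) x.ne_zero
  · exact ⟨x, mem_totallyPositive.2 ⟨h, hx⟩, rfl⟩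

theorem nrm_mul_inv [PosFundDisc D] (x : (QField D)ˣ) :
    nrm (x : QField D) * nrm ((x⁻¹ : (QField D)ˣ) : QField D) = 1 := by
  rw [← nrm_mul, Units.mul_inv, nrm_one]

namespace QForm

/-- The coefficients of `Q ∘ A`. -/
theorem IsTranslate.coeffs {Q Q' : QForm D} {A : SL(2, ℤ)} (h : Q.IsTranslate Q' A) :
    Q'.a = Q.a * A 0 0 ^ 2 + Q.b * A 0 0 * A 1 0 + Q.c * A 1 0 ^ 2 ∧
    Q'.b = 2 * Q.a * A 0 0 * A 0 1 + Q.b * (A 0 0 * A 1 1 + A 0 1 * A 1 0) +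
      2 * Q.c * A 1 0 * A 1 1 ∧
    Q'.c = Q.a * A 0 1 ^ 2 + Q.b * A 0 1 * A 1 1 + Q.c * A 1 1 ^ 2 := by
  have ea := h 1 0
  have eb := h 1 1
  have ec := h 0 1
  simp only [eval] at ea eb ec
  refine ⟨?_, ?_, ?_⟩
  · linear_combination ea
  · linear_combination eb - ea - ec
  · linear_combination ec

theorem even_sub (Q : QForm D) {t u : ℤ} (h : 4 ∣ t ^ 2 - D * u ^ 2) : Even (t - Q.b * u) := by
  obtain ⟨n, hn⟩ := h
  have h1 : (t - Q.b * u) ^ 2 = 2 * (2 * n - 2 * Q.a * Q.c * u ^ 2 - Q.b * u * t +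
      Q.b ^ 2 * u ^ 2) := by
    linear_combination hn - u ^ 2 * Q.disc
  have h2 : Even ((t - Q.b * u) ^ 2) := ⟨_, by rw [h1, two_mul]⟩
  exact (Int.even_pow.1 h2).1

/-- The linear form `a x + (b - √D) / 2 · y`, whose norm is `a · Q(x, y)`. -/
noncomputable def lin (Q : QForm D) (x y : ℤ) : QField D := Q.a * x + (Q.b - sqrtD D) / 2 * y

theorem sqrtD_sq_eq [PosFundDisc D] (Q : QForm D) :
    sqrtD D ^ 2 = (Q.b : QField D) ^ 2 - 4 * Q.a * Q.c := by
  rw [sqrtD_sq]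
  exact_mod_cast Q.disc.symm

theorem conj_lin [PosFundDisc D] (Q : QForm D) (x y : ℤ) :
    conj D (Q.lin x y) = Q.a * x + (Q.b + sqrtD D) / 2 * y := by
  simp only [lin, map_add, map_mul, map_div₀, map_sub, map_intCast, conj_sqrtD, map_ofNat,
    sub_neg_eq_add]

theorem lin_mul_conj [PosFundDisc D] (Q : QForm D) (x y : ℤ) :
    Q.lin x y * conj D (Q.lin x y) = Q.a * Q.eval x y := by
  rw [conj_lin, lin, eval]
  push_cast
  linear_combination (-y ^ 2 / 4 : QField D) * Q.sqrtD_sq_eq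

theorem nrm_lin [PosFundDisc D] (Q : QForm D) (x y : ℤ) :
    nrm (Q.lin x y) = Q.a * Q.eval x y := by
  rw [nrm, lin_mul_conj]; simp

/-- The additive group spanned by `a` and `(b - √D) / 2` is already an ideal. -/
theorem mem_ideal [PosFundDisc D] (Q : QForm D) (z : QField D) :
    z ∈ Q.ideal ↔ ∃ x y : ℤ, z = Q.lin x y := by
  have hq := Q.sqrtD_sq_eq
  have hmem : z ∈ Q.ideal ↔ ∃ r s : 𝓞 (QField D),
      (r : QField D) * Q.a + s * ((-(Q.b : QField D) + sqrtD D) / 2) = z := by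
    rw [ideal, ← FractionalIdeal.mem_coe, FractionalIdeal.coe_add, Submodule.add_eq_sup,
      Submodule.mem_sup]
    simp only [FractionalIdeal.mem_coe, FractionalIdeal.mem_spanSingleton]
    constructor
    · rintro ⟨_, ⟨r, rfl⟩, _, ⟨s, rfl⟩, h⟩
      exact ⟨r, s, h⟩
    · rintro ⟨r, s, h⟩
      exact ⟨_, ⟨r, rfl⟩, _, ⟨s, rfl⟩, h⟩
  have hint : ∀ r : 𝓞 (QField D), ∃ k u : ℤ,
      (r : QField D) = k + u * ((Q.b + sqrtD D) / 2) := by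
    intro r
    obtain ⟨t, u, h, hdvd⟩ := isIntegral_iff.1 r.2
    obtain ⟨k, hk⟩ := Q.even_sub hdvd
    have hk' : (t : QField D) - Q.b * u = k + k := by exact_mod_cast hk
    exact ⟨k, u, h.trans (by linear_combination hk' / 2)⟩
  rw [hmem]
  constructor
  · rintro ⟨r, s, rfl⟩
    obtain ⟨k, u, hr⟩ := hint r
    obtain ⟨l, v, hs⟩ := hint s
    refine ⟨k + u * Q.b - Q.c * v, -u * Q.a - l, ?_⟩
    rw [hr, hs, lin]
    push_cast
    linear_combination (v / 4 : QField D) * hq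
  · rintro ⟨x, y, rfl⟩
    refine ⟨x, -y, ?_⟩
    rw [lin]
    simp only [map_neg, map_intCast]
    ring

/-- If the oriented basis `(1, 0), (0, 1)` of the lattice of `Q'` is `μ` times the image of the
matrix `(p, q; r, s)` in the lattice of `Q`, then the orientations compare as
`det · N(μ) · a = a'`. -/
theorem det_mul_nrm [hD : PosFundDisc D] {Q Q' : QForm D} {μ : QField D} {p q r s : ℤ}
    (h1 : Q'.lin 1 0 = μ * Q.lin p r) (h2 : Q'.lin 0 1 = μ * Q.lin q s) :
    ((p * s - q * r : ℤ) : ℝ) * nrm μ * Q.a = Q'.a := by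
  have h1' := congrArg (conj D) h1
  have h2' := congrArg (conj D) h2
  rw [map_mul, conj_lin, conj_lin] at h1' h2'
  rw [lin, lin] at h1 h2
  push_cast at h1 h2 h1' h2'
  have e : sqrtD D * (((p * s - q * r : ℤ) : QField D) * (μ * conj D μ) * Q.a) =
      sqrtD D * Q'.a := by
    push_cast
    have e1 := congrArg₂ (· * ·) h1 h2'
    have e2 := congrArg₂ (· * ·) h1' h2
    beta_reduce at e1 e2
    linear_combination e2 - e1
  have e' := congrArg (Subtype.val) (mul_left_cancel₀ (sqrtD_ne_zero D) e)
  rw [nrm]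
  exact e'

/-- Bases of two lattices that agree up to `μ` and a unimodular substitution give ideals that agree
up to `μ`. -/
theorem spanSingleton_mul_ideal_eq [PosFundDisc D] {Q Q' : QForm D} {μ : QField D} (A : SL(2, ℤ))
    (h : ∀ x y, Q'.lin x y = μ * Q.lin (A 0 0 * x + A 0 1 * y) (A 1 0 * x + A 1 1 * y)) :
    FractionalIdeal.spanSingleton _ μ * Q.ideal = Q'.ideal := by
  have hd := det_eq_one A
  ext z
  rw [FractionalIdeal.mem_singleton_mul, mem_ideal]
  constructor
  · rintro ⟨w, hw, rfl⟩
    obtain ⟨x, y, rfl⟩ := (Q.mem_ideal w).1 hw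
    refine ⟨A 1 1 * x - A 0 1 * y, A 0 0 * y - A 1 0 * x, ?_⟩
    rw [h]
    congr 2
    · linear_combination -x * hd
    · linear_combination -y * hd
  · rintro ⟨x, y, rfl⟩
    exact ⟨_, (Q.mem_ideal _).2 ⟨_, _, rfl⟩, h x y⟩

/-- `1` if `a > 0` and `√D` otherwise: the twist in the definition of the ideal class of a form. -/
noncomputable def twist [PosFundDisc D] (Q : QForm D) : (QField D)ˣ :=
  if 0 < Q.a then 1 else Units.mk0 (sqrtD D) (sqrtD_ne_zero D)

theorem nrm_twist_mul_pos [hD : PosFundDisc D] (Q : QForm D) :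
    0 < nrm (Q.twist : QField D) * Q.a := by
  rw [twist]
  split_ifs with h
  · rw [Units.val_one, nrm_one, one_mul]; exact_mod_cast h
  · have h1 : Q.a < 0 := lt_of_le_of_ne (not_lt.1 h) Q.a_ne_zero
    rw [Units.val_mk0, nrm_sqrtD]
    have h2 : (0 : ℝ) < D := by exact_mod_cast hD.pos
    have h3 : (Q.a : ℝ) < 0 := by exact_mod_cast h1
    nlinarith

theorem idealClass_eq_mk [PosFundDisc D] (Q : QForm D) :
    Q.idealClass = QuotientGroup.mk (s := narrowPrincipal D)
      (toPrincipalIdeal (𝓞 (QField D)) (QField D) Q.twist * Units.mk0 Q.ideal Q.ideal_ne_zero) := by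
  rw [idealClass, twist]
  split_ifs
  · rw [map_one, one_mul]
  · rfl

/-- Two forms have the same narrow class when their ideals differ by a factor `μ` whose norm has the
sign of `a a'`. -/
theorem idealClass_eq_iff [PosFundDisc D] (Q Q' : QForm D) :
    Q.idealClass = Q'.idealClass ↔ ∃ μ : (QField D)ˣ, 0 < nrm (μ : QField D) * Q.a * Q'.a ∧
      FractionalIdeal.spanSingleton _ (μ : QField D) * Q.ideal = Q'.ideal := by
  have h1 := Q.nrm_twist_mul_pos
  have h2 := Q'.nrm_twist_mul_pos
  have h3 := nrm_mul_inv Q.twist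
  have h4 := nrm_mul_inv Q'.twist
  have hcomm : ∀ x y z w : (FractionalIdeal (𝓞 (QField D))⁰ (QField D))ˣ,
      (x * y)⁻¹ * (z * (w * y)) = w * z * x⁻¹ := fun x y z w => by
    rw [inv_mul_eq_iff_eq_mul, ← mul_assoc z, mul_right_comm x, mul_comm z w,
      mul_comm x (w * z * x⁻¹), inv_mul_cancel_right]
  rw [idealClass_eq_mk, idealClass_eq_mk]
  refine QuotientGroup.eq.trans ?_
  constructor
  · rintro ⟨ν, hν, h⟩
    have hν' := (mem_totallyPositive.1 hν).2
    refine ⟨ν * Q.twist * Q'.twist⁻¹, ?_, ?_⟩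
    · rw [Units.val_mul, Units.val_mul, nrm_mul, nrm_mul]
      have e : nrm (ν : QField D) * nrm (Q.twist : QField D) *
          nrm ((Q'.twist⁻¹ : (QField D)ˣ) : QField D) * Q.a * Q'.a =
          nrm (ν : QField D) * (nrm (Q.twist : QField D) * Q.a) *
          ((nrm (Q'.twist : QField D) * Q'.a) *
            nrm ((Q'.twist⁻¹ : (QField D)ˣ) : QField D) ^ 2) := by
        linear_combination (-nrm (ν : QField D) * nrm (Q.twist : QField D) *
          nrm ((Q'.twist⁻¹ : (QField D)ˣ) : QField D) * Q.a * Q'.a) * h4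
      rw [e]
      have : nrm ((Q'.twist⁻¹ : (QField D)ˣ) : QField D) ≠ 0 := right_ne_zero_of_mul_eq_one h4
      positivity
    · have h5 : toPrincipalIdeal (𝓞 (QField D)) (QField D) (ν * Q.twist * Q'.twist⁻¹) *
          Units.mk0 Q.ideal Q.ideal_ne_zero = Units.mk0 Q'.ideal Q'.ideal_ne_zero := by
        rw [map_mul, map_mul, map_inv]
        rw [eq_inv_mul_iff_mul_eq] at h
        rw [mul_right_comm, mul_inv_eq_iff_eq_mul, mul_comm (Units.mk0 Q'.ideal _), ← h,
          mul_assoc, mul_comm]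
      have := congrArg Units.val h5
      simpa using this
  · rintro ⟨μ, hμ, h⟩
    have h5 : Units.mk0 Q'.ideal Q'.ideal_ne_zero =
        toPrincipalIdeal (𝓞 (QField D)) (QField D) μ * Units.mk0 Q.ideal Q.ideal_ne_zero := by
      apply Units.ext
      simpa using h.symm
    rw [h5, hcomm, ← map_inv, ← map_mul, ← map_mul]
    apply toPrincipalIdeal_mem_narrowPrincipal
    rw [Units.val_mul, Units.val_mul, nrm_mul, nrm_mul]
    have hinv : nrm ((Q.twist⁻¹ : (QField D)ˣ) : QField D) ≠ 0 := right_ne_zero_of_mul_eq_one h3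
    have ha : (Q.a : ℝ) ≠ 0 := by exact_mod_cast Q.a_ne_zero
    have ha' : (Q'.a : ℝ) ≠ 0 := by exact_mod_cast Q'.a_ne_zero
    have e : nrm (μ : QField D) * nrm (Q'.twist : QField D) *
        nrm ((Q.twist⁻¹ : (QField D)ˣ) : QField D) * (Q.a ^ 2 * Q'.a ^ 2) =
        (nrm (μ : QField D) * Q.a * Q'.a) * (nrm (Q'.twist : QField D) * Q'.a) *
        ((nrm (Q.twist : QField D) * Q.a) *
          nrm ((Q.twist⁻¹ : (QField D)ˣ) : QField D) ^ 2) := by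
      linear_combination (-nrm (μ : QField D) * nrm (Q'.twist : QField D) *
        nrm ((Q.twist⁻¹ : (QField D)ˣ) : QField D) * (Q.a ^ 2 * Q'.a ^ 2)) * h3
    refine pos_of_mul_pos_left (b := (Q.a ^ 2 * Q'.a ^ 2 : ℝ)) ?_ (by positivity)
    rw [e]
    positivity

/-- Equivalent forms have the same ideal class. With `λ = Q.lin p r` the value of the linear form at
the first column of `A`, the factor between the ideals is `μ = λ' / a`, of norm `a' / a`. -/
theorem idealClass_eq_of_isTranslate [PosFundDisc D] {Q Q' : QForm D} {A : SL(2, ℤ)}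
    (h : Q.IsTranslate Q' A) : Q.idealClass = Q'.idealClass := by
  have hd := det_eq_one A
  obtain ⟨ea', eb, -⟩ := h.coeffs
  have ea : Q'.a = Q.eval (A 0 0) (A 1 0) := ea'
  obtain ⟨p, hp⟩ : ∃ p, A 0 0 = p := ⟨_, rfl⟩
  obtain ⟨q, hq⟩ : ∃ q, A 0 1 = q := ⟨_, rfl⟩
  obtain ⟨r, hr⟩ : ∃ r, A 1 0 = r := ⟨_, rfl⟩
  obtain ⟨s, hs⟩ : ∃ s, A 1 1 = s := ⟨_, rfl⟩
  rw [hp, hq, hr, hs] at eb hd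
  rw [hp, hr] at ea
  have ha : (Q.a : QField D) ≠ 0 := by exact_mod_cast Q.a_ne_zero
  have ha' : (Q'.a : QField D) ≠ 0 := by exact_mod_cast Q'.a_ne_zero
  have hl : Q.lin p r * conj D (Q.lin p r) = Q.a * Q'.a := by rw [lin_mul_conj, ea]
  have hl0 : Q.lin p r ≠ 0 := left_ne_zero_of_mul (hl ▸ mul_ne_zero ha ha')
  have hc0 : conj D (Q.lin p r) ≠ 0 := (map_ne_zero _).2 hl0
  have hμ : conj D (Q.lin p r) / Q.a * Q.lin p r = Q'.a := by
    rw [div_mul_eq_mul_div, mul_comm, hl, mul_div_cancel_left₀ _ ha]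
  rw [idealClass_eq_iff]
  refine ⟨Units.mk0 (conj D (Q.lin p r) / Q.a) (div_ne_zero hc0 ha), ?_,
    spanSingleton_mul_ideal_eq A fun x y => ?_⟩
  · have h1 := congrArg nrm hμ
    have hint : ∀ n : ℤ, nrm (n : QField D) = (n : ℝ) ^ 2 := fun n => by simp [nrm, sq]
    rw [nrm_mul, nrm_lin, ← ea, hint] at h1
    rw [Units.val_mk0, mul_assoc, h1]
    have : (Q'.a : ℝ) ≠ 0 := by exact_mod_cast Q'.a_ne_zero
    positivity
  · rw [hp, hq, hr, hs]
    have hb : (Q'.b : QField D) = 2 * Q.a * p * q + Q.b * (p * s + q * r) + 2 * Q.c * r * s := by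
      rw [eb]; push_cast; ring
    have hA : (Q'.a : QField D) = Q.a * p ^ 2 + Q.b * p * r + Q.c * r ^ 2 := by
      rw [ea, eval]; push_cast; ring
    have hd' : (p * s - q * r : QField D) = 1 := by exact_mod_cast hd
    rw [Units.val_mk0, div_mul_eq_mul_div, eq_div_iff ha, conj_lin, lin, lin, hb, hA]
    push_cast
    linear_combination (r * (r * x + s * y) / 4 : QField D) * Q.sqrtD_sq_eq +
      (Q.a * y * sqrtD D / 2 : QField D) * hd'

/-- Forms with the same ideal class are equivalent. The matrix of the base change between the two
lattices has determinant `±1`, and the sign condition on the norm makes it `1`. -/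
theorem exists_isTranslate_of_idealClass_eq [PosFundDisc D] {Q Q' : QForm D}
    (h : Q.idealClass = Q'.idealClass) : ∃ A : SL(2, ℤ), Q.IsTranslate Q' A := by
  obtain ⟨μ, hμ, hI⟩ := (idealClass_eq_iff Q Q').1 h
  have key : ∀ x y : ℤ, ∃ x' y' : ℤ, Q'.lin x y = μ * Q.lin x' y' := fun x y => by
    have : Q'.lin x y ∈ Q'.ideal := (Q'.mem_ideal _).2 ⟨x, y, rfl⟩
    rw [← hI, FractionalIdeal.mem_singleton_mul] at this
    obtain ⟨w, hw, hz⟩ := this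
    obtain ⟨x', y', rfl⟩ := (Q.mem_ideal w).1 hw
    exact ⟨x', y', hz⟩
  have key' : ∀ x y : ℤ, ∃ x' y' : ℤ,
      Q.lin x y = ((μ⁻¹ : (QField D)ˣ) : QField D) * Q'.lin x' y' := fun x y => by
    have : (μ : QField D) * Q.lin x y ∈ Q'.ideal := by
      rw [← hI, FractionalIdeal.mem_singleton_mul]
      exact ⟨_, (Q.mem_ideal _).2 ⟨x, y, rfl⟩, rfl⟩
    obtain ⟨x', y', hz⟩ := (Q'.mem_ideal _).1 this
    exact ⟨x', y', by rw [← hz, Units.inv_mul_cancel_left]⟩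
  obtain ⟨p, r, h1⟩ := key 1 0
  obtain ⟨q, s, h2⟩ := key 0 1
  obtain ⟨p', r', h1'⟩ := key' 1 0
  obtain ⟨q', s', h2'⟩ := key' 0 1
  have d1 := det_mul_nrm h1 h2
  have d2 := det_mul_nrm h1' h2'
  have ha : (Q.a : ℝ) ≠ 0 := by exact_mod_cast Q.a_ne_zero
  have ha' : (Q'.a : ℝ) ≠ 0 := by exact_mod_cast Q'.a_ne_zero
  have hn := nrm_mul_inv μ
  have hunit : (p * s - q * r) * (p' * s' - q' * r') = 1 := by
    have : (((p * s - q * r : ℤ) : ℝ) * ((p' * s' - q' * r' : ℤ) : ℝ)) * Q.a = 1 * Q.a := by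
      rw [one_mul]
      nth_rewrite 2 [← d2]
      rw [← d1]
      linear_combination (-((p * s - q * r : ℤ) : ℝ) * ((p' * s' - q' * r' : ℤ) : ℝ) * Q.a) * hn
    exact_mod_cast mul_right_cancel₀ ha this
  have hpos : 0 < p * s - q * r := by
    have h3 : ((p * s - q * r : ℤ) : ℝ) * (nrm (μ : QField D) * Q.a * Q'.a) = (Q'.a : ℝ) ^ 2 := by
      linear_combination Q'.a * d1
    have h4 : (0 : ℝ) < (Q'.a : ℝ) ^ 2 := by positivity
    rw [← h3] at h4
    exact_mod_cast pos_of_mul_pos_left h4 hμ.le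
  have hdet : p * s - q * r = 1 :=
    (Int.eq_one_or_neg_one_of_mul_eq_one hunit).resolve_right (by omega)
  rw [hdet, Int.cast_one, one_mul] at d1
  refine ⟨⟨!![p, q; r, s], by rw [Matrix.det_fin_two_of, hdet]⟩, fun x y => ?_⟩
  have hlin : Q'.lin x y = μ * Q.lin (p * x + q * y) (r * x + s * y) := by
    have e1 : Q'.lin x y = x * Q'.lin 1 0 + y * Q'.lin 0 1 := by simp only [lin]; push_cast; ring
    rw [e1, h1, h2]
    simp only [lin]; push_cast; ring
  have h5 := congrArg nrm hlin
  rw [nrm_mul, nrm_lin, nrm_lin, ← mul_assoc, d1] at h5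
  have h6 := mul_left_cancel₀ ha' h5
  have h7 : Q'.eval x y = Q.eval (p * x + q * y) (r * x + s * y) := by exact_mod_cast h6
  simpa using h7

end QForm

/-! ### Every ideal comes from a form -/

theorem half_coords_inj [PosFundDisc D] {t u t' u' : ℤ}
    (h : ((t + u * sqrtD D) / 2 : QField D) = (t' + u' * sqrtD D) / 2) : t = t' ∧ u = u' := by
  obtain ⟨h1, h2⟩ := rat_coords_inj (D := D) (r := t) (s := u) (r' := t') (s' := u') (by
    push_cast; linear_combination 2 * h)
  exact ⟨by exact_mod_cast h1, by exact_mod_cast h2⟩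

theorem four_dvd_disc_sq_sub [hD : PosFundDisc D] : 4 ∣ D ^ 2 - D := by
  rcases hD.fundamental with ⟨h, -⟩ | ⟨h, -⟩
  · obtain ⟨k, rfl⟩ : ∃ k, D = 4 * k + 1 := ⟨D / 4, by omega⟩
    exact ⟨4 * k ^ 2 + k, by ring⟩
  · obtain ⟨k, rfl⟩ := Int.dvd_of_emod_eq_zero h
    exact ⟨4 * k ^ 2 - k, by ring⟩

theorem exists_pos_generator {H : AddSubgroup ℤ} {n : ℤ} (hn : n ∈ H) (h0 : n ≠ 0) :
    ∃ d : ℤ, 0 < d ∧ ∀ m, m ∈ H ↔ d ∣ m := by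
  obtain ⟨d, rfl⟩ := Int.subgroup_cyclic H
  rw [← AddSubgroup.zmultiples_eq_closure] at hn ⊢
  have hd : d ≠ 0 := by
    rintro rfl
    rw [Int.mem_zmultiples_iff, zero_dvd_iff] at hn
    exact h0 hn
  exact ⟨|d|, abs_pos.2 hd, fun m => by rw [Int.mem_zmultiples_iff, abs_dvd]⟩

/-- Every nonzero integral ideal is a positive integer times the ideal of a form with `a > 0`. The
integers `d` and `a d` generate the group of `√D`-coordinates of the ideal and the group of
rational integers in the ideal. -/
theorem exists_form_of_ideal [hD : PosFundDisc D] {J : Ideal (𝓞 (QField D))} (hJ : J ≠ ⊥) :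
    ∃ Q : QForm D, 0 < Q.a ∧ ∃ d : ℤ, 0 < d ∧
      (J : FractionalIdeal (𝓞 (QField D))⁰ (QField D)) =
        FractionalIdeal.spanSingleton _ (d : QField D) * Q.ideal := by
  have hq := sqrtD_sq (D := D)
  set L : FractionalIdeal (𝓞 (QField D))⁰ (QField D) :=
    (J : FractionalIdeal (𝓞 (QField D))⁰ (QField D))
  have hsmul : ∀ r z : QField D, IsIntegral ℤ r → z ∈ L → r * z ∈ L := fun r z hr hz => by
    rw [← FractionalIdeal.mem_coe] at hz ⊢
    exact Submodule.smul_mem (L : Submodule (𝓞 (QField D)) (QField D)) (⟨r, hr⟩ : 𝓞 (QField D)) hz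
  have hadd : ∀ z w : QField D, z ∈ L → w ∈ L → z + w ∈ L := fun z w hz hw => by
    rw [← FractionalIdeal.mem_coe] at hz hw ⊢
    exact Submodule.add_mem _ hz hw
  have hzmul : ∀ (n : ℤ) (z : QField D), z ∈ L → (n : QField D) * z ∈ L := fun n z hz =>
    hsmul _ _ (by simpa using isIntegral_algebraMap (R := ℤ) (A := QField D) (x := n)) hz
  have hneg : ∀ z : QField D, z ∈ L → -z ∈ L := fun z hz => by
    simpa using hzmul (-1) z hz
  have hsub : ∀ z w : QField D, z ∈ L → w ∈ L → z - w ∈ L := fun z w hz hw => by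
    rw [sub_eq_add_neg]; exact hadd _ _ hz (hneg _ hw)
  have hcoord : ∀ z ∈ L, ∃ t u : ℤ, z = (t + u * sqrtD D) / 2 ∧ 4 ∣ t ^ 2 - D * u ^ 2 := by
    intro z hz
    obtain ⟨x, -, rfl⟩ := (FractionalIdeal.mem_coeIdeal _).1 hz
    exact isIntegral_iff.1 x.2
  obtain ⟨D', hD'⟩ := four_dvd_disc_sq_sub (D := D)
  have hω : IsIntegral ℤ ((D + sqrtD D) / 2 : QField D) :=
    isIntegral_iff.2 ⟨D, 1, by push_cast; ring, D', by linarith⟩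
  -- a nonzero rational integer in the ideal
  obtain ⟨n, hn0, hn⟩ : ∃ n : ℤ, n ≠ 0 ∧ (n : QField D) ∈ L := by
    obtain ⟨x, hx, hx0⟩ := Submodule.exists_mem_ne_zero_of_ne_bot hJ
    obtain ⟨t, u, h, m, hm⟩ := isIntegral_iff.1 x.2
    have hxL : ((t + u * sqrtD D) / 2 : QField D) ∈ L := by
      rw [← h]; exact FractionalIdeal.mem_coeIdeal_of_mem _ hx
    have hc : IsIntegral ℤ ((t + (-u : ℤ) * sqrtD D) / 2 : QField D) :=
      isIntegral_iff.2 ⟨t, -u, rfl, m, by rw [neg_sq, hm]⟩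
    have hm' : (t : QField D) ^ 2 - D * u ^ 2 = 4 * m := by exact_mod_cast hm
    have e : ((t + (-u : ℤ) * sqrtD D) / 2 : QField D) * ((t + u * sqrtD D) / 2) = m := by
      push_cast; linear_combination (-u ^ 2 / 4 : QField D) * hq + hm' / 4
    refine ⟨m, ?_, e ▸ hsmul _ _ hc hxL⟩
    rintro rfl
    have h1 : nrm ((t + u * sqrtD D) / 2 : QField D) = 0 := by
      rw [nrm_half]
      have : (t ^ 2 - D * u ^ 2 : ℝ) = 0 := by exact_mod_cast hm
      rw [this, zero_div]
    refine nrm_ne_zero (D := D) ?_ h1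
    rw [← h]
    exact fun h0 => hx0 (Subtype.ext h0)
  let E : AddSubgroup ℤ :=
    { carrier := {e | (e : QField D) ∈ L}
      zero_mem' := by simpa using hzmul 0 _ hn
      add_mem' := fun ha hb => by simpa using hadd _ _ ha hb
      neg_mem' := fun ha => by simpa using hneg _ ha }
  let U : AddSubgroup ℤ :=
    { carrier := {u | ∃ t : ℤ, ((t + u * sqrtD D) / 2 : QField D) ∈ L}
      zero_mem' := ⟨0, by simpa using hzmul 0 _ hn⟩
      add_mem' := by
        rintro u v ⟨t, ht⟩ ⟨s, hs⟩
        refine ⟨t + s, ?_⟩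
        convert hadd _ _ ht hs using 1
        push_cast; ring
      neg_mem' := by
        rintro u ⟨t, ht⟩
        refine ⟨-t, ?_⟩
        convert hneg _ ht using 1
        push_cast; ring }
  have hEU : ∀ e ∈ E, e ∈ U := fun e he => ⟨D * e, by
    have h := hsmul _ _ hω (show (e : QField D) ∈ L from he)
    convert h using 1
    push_cast; ring⟩
  obtain ⟨e, he, hE⟩ := exists_pos_generator (H := E) hn hn0
  obtain ⟨d, hd, hU⟩ := exists_pos_generator (H := U) (hEU n hn) hn0
  obtain ⟨a, ha⟩ := (hU e).1 (hEU e ((hE e).2 dvd_rfl))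
  obtain ⟨t, ht⟩ := (hU d).2 dvd_rfl
  have ha0 : 0 < a := pos_of_mul_pos_right (ha ▸ he) hd.le
  -- multiplication by `(D + √D) / 2` shows that `t` is a multiple of `d`
  obtain ⟨k, hk⟩ : ∃ k, t = d * (2 * k - D) := by
    have h1 := hsmul _ _ hω ht
    obtain ⟨t₁, u₁, h2, -⟩ := hcoord _ h1
    have h3 : u₁ ∈ U := ⟨t₁, h2 ▸ h1⟩
    obtain ⟨k, hk⟩ := (hU u₁).1 h3
    have h4 := (rat_coords_inj (D := D) (r := (D * t + D * d) / 4) (s := (D * d + t) / 4)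
      (r' := t₁ / 2) (s' := u₁ / 2) (by
        push_cast; rw [← hq] at h2 ⊢; linear_combination h2)).2
    have h5 : (D * d + t : ℚ) = 2 * u₁ := by linarith
    have h6 : D * d + t = 2 * u₁ := by exact_mod_cast h5
    exact ⟨k, by linear_combination h6 + 2 * hk⟩
  obtain ⟨c, hc⟩ : ∃ c, (D - 2 * k) ^ 2 - 4 * a * c = D := by
    have h1 := hsmul _ _ hω ht
    have h2 := hsub _ _ h1 (hzmul k _ ht)
    have h3 : d * (D' - D * k + k ^ 2) ∈ E := by
      have h4 := hneg _ h2
      change ((d * (D' - D * k + k ^ 2) : ℤ) : QField D) ∈ L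
      convert h4 using 1
      have h5 : (D : QField D) ^ 2 - D = 4 * D' := by exact_mod_cast hD'
      rw [hk]
      push_cast
      linear_combination (d / 4 : QField D) * hq - d / 4 * h5
    obtain ⟨c, hc⟩ := (hE _).1 h3
    refine ⟨c, ?_⟩
    have h6 : D' - D * k + k ^ 2 = a * c := by
      apply mul_left_cancel₀ hd.ne'
      rw [hc, ha]; ring
    linear_combination hD' + 4 * h6
  refine ⟨⟨a, D - 2 * k, c, primitive_of_disc hc, hc⟩, ha0, d, hd, ?_⟩
  ext z
  rw [FractionalIdeal.mem_singleton_mul]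
  constructor
  · intro hz
    obtain ⟨t', u', h1, -⟩ := hcoord z hz
    obtain ⟨y, hy⟩ := (hU u').1 ⟨t', h1 ▸ hz⟩
    have h2 := hsub _ _ hz (hzmul y _ ht)
    obtain ⟨s, v, h3, h4⟩ := hcoord _ h2
    obtain ⟨h5, h6⟩ := half_coords_inj (D := D) (t := t' - y * t) (u := u' - y * d) (t' := s)
      (u' := v) (by rw [← h3, h1]; push_cast; ring)
    have hv : v = 0 := by rw [← h6, hy]; ring
    subst hv
    have h7 : Even s := by
      have : Even (s ^ 2) := by
        obtain ⟨j, hj⟩ := h4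
        exact ⟨2 * j, by linarith⟩
      exact (Int.even_pow.1 this).1
    obtain ⟨j, hj⟩ := h7
    have h8 : j ∈ E := by
      change (j : QField D) ∈ L
      convert h2 using 1
      rw [h3, hj]
      push_cast; ring
    obtain ⟨x, hx⟩ := (hE j).1 h8
    refine ⟨_, (QForm.mem_ideal _ _).2 ⟨x, -y, rfl⟩, ?_⟩
    rw [QForm.lin]
    have h9 : z = j + y * ((t + d * sqrtD D) / 2) := by
      rw [hj] at h3; push_cast at h3; linear_combination h3
    rw [h9, hx, ha, hk]
    push_cast; ring
  · rintro ⟨w, hw, rfl⟩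
    obtain ⟨x, y, rfl⟩ := (QForm.mem_ideal _ _).1 hw
    have h1 := hadd _ _ (hzmul x _ (show (e : QField D) ∈ L from (hE e).2 dvd_rfl))
      (hzmul (-y) _ ht)
    convert h1 using 1
    rw [QForm.lin, ha, hk]
    push_cast; ring

/-- Every narrow class comes from a form. An ideal is scaled to an integral one by a square, whose
norm is positive. -/
theorem exists_idealClass_eq [PosFundDisc D] (𝔞 : NarrowClassGroup D) :
    ∃ Q : QForm D, Q.idealClass = 𝔞 := by
  obtain ⟨I, rfl⟩ := QuotientGroup.mk_surjective (s := narrowPrincipal D) 𝔞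
  obtain ⟨r, J, hr, hI⟩ := FractionalIdeal.exists_eq_spanSingleton_mul
    (I : FractionalIdeal (𝓞 (QField D))⁰ (QField D))
  have hr' : (r : QField D) ≠ 0 := fun h => hr (Subtype.ext h)
  have hJ : J ≠ ⊥ := by
    rintro rfl
    exact I.ne_zero (by rw [hI]; simp)
  obtain ⟨Q, ha, d, hd, hQ⟩ := exists_form_of_ideal (J := Ideal.span {r} * J)
    (mul_ne_zero (by simpa using hr) hJ)
  have hd' : (d : QField D) ≠ 0 := by exact_mod_cast hd.ne'
  refine ⟨Q, ?_⟩
  rw [QForm.idealClass, if_pos ha]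
  refine QuotientGroup.eq.2 ?_
  -- `I = (d / r²) · I_Q`
  have hν : toPrincipalIdeal (𝓞 (QField D)) (QField D)
      (Units.mk0 (d / (r : QField D) ^ 2) (div_ne_zero hd' (pow_ne_zero 2 hr'))) *
        Units.mk0 Q.ideal Q.ideal_ne_zero = I := by
    apply Units.ext
    rw [Units.val_mul, coe_toPrincipalIdeal, Units.val_mk0, Units.val_mk0, hI]
    rw [FractionalIdeal.coeIdeal_mul, FractionalIdeal.coeIdeal_span_singleton] at hQ
    have e1 : (d / (r : QField D) ^ 2) = ((r : QField D) ^ 2)⁻¹ * d := by rw [div_eq_inv_mul]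
    rw [e1, ← FractionalIdeal.spanSingleton_mul_spanSingleton, mul_assoc, ← hQ, ← mul_assoc,
      FractionalIdeal.spanSingleton_mul_spanSingleton]
    congr 2
    field_simp
  rw [← hν, mul_comm, mul_assoc, mul_inv_cancel, mul_one]
  apply toPrincipalIdeal_mem_narrowPrincipal
  have e : (d / (r : QField D) ^ 2) * (r : QField D) ^ 2 = d := by field_simp
  have e2 := congrArg nrm e
  have hint : nrm (d : QField D) = (d : ℝ) ^ 2 := by simp [nrm, sq]
  rw [sq (r : QField D), nrm_mul, nrm_mul, hint, ← sq (r : QField D)] at e2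
  rw [Units.val_mk0]
  have h1 : nrm (r : QField D) ≠ 0 := nrm_ne_zero hr'
  have h2 : (0 : ℝ) < (d : ℝ) ^ 2 := by
    have : (d : ℝ) ≠ 0 := by exact_mod_cast hd.ne'
    positivity
  rw [← e2] at h2
  exact pos_of_mul_pos_left h2 (mul_self_nonneg _)

/-! ### Geodesics of forms -/

/-- The length `log ε_D²` of each closed geodesic of discriminant `D`. -/
noncomputable def period (D : ℤ) : ℝ := 2 * Real.log (epsilonD D)

theorem period_pos (D : ℤ) [PosFundDisc D] : 0 < period D :=
  mul_pos two_pos (Real.log_pos (one_lt_epsilonD D))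

theorem exp_period (D : ℤ) [PosFundDisc D] : Real.exp (period D) = epsilonD D ^ 2 := by
  have hε : 0 < epsilonD D := zero_lt_one.trans (one_lt_epsilonD D)
  rw [period, two_mul, Real.exp_add, Real.exp_log hε, sq]

namespace QForm

theorem root_add_conjRoot [PosFundDisc D] (Q : QForm D) :
    (Q.a : ℝ) * (Q.root + Q.conjRoot) = -Q.b := by
  have : (Q.a : ℝ) ≠ 0 := by exact_mod_cast Q.a_ne_zero
  rw [root, conjRoot]
  field_simp
  ring

theorem root_mul_conjRoot [PosFundDisc D] (Q : QForm D) :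
    (Q.a : ℝ) * (Q.root * Q.conjRoot) = Q.c := by
  linear_combination Q.root * Q.root_add_conjRoot - Q.root_eq.1

theorem coe_kappa_smul [PosFundDisc D] (Q : QForm D) (z : ℍ) :
    ((Q.kappa • z : ℍ) : ℂ) = (z - Q.root) / (z - Q.conjRoot) := by
  have hpos : 0 < Q.root - Q.conjRoot := sub_pos.2 Q.conjRoot_lt_root
  have hr : (((√(Q.root - Q.conjRoot))⁻¹ : ℝ) : ℂ) ≠ 0 := by
    exact_mod_cast inv_ne_zero (Real.sqrt_pos.2 hpos).ne'
  rw [UpperHalfPlane.coe_specialLinearGroup_apply]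
  refine Eq.trans ?_ (mul_div_mul_left _ _ hr)
  simp [kappa]
  ring

theorem one_sub_I_mul_ne_zero (y : ℝ) : (-(Complex.I * y) + 1 : ℂ) ≠ 0 := by
  intro h
  simpa using congrArg Complex.re h

theorem coe_liftPoint [PosFundDisc D] (Q : QForm D) (y : ℝ) (hy : 0 < y) :
    ((Q.liftPoint y hy : ℍ) : ℂ) =
      (-Q.conjRoot * (Complex.I * y) + Q.root) / (-(Complex.I * y) + 1) := by
  have hpos : 0 < Q.root - Q.conjRoot := sub_pos.2 Q.conjRoot_lt_root
  have hr : (((√(Q.root - Q.conjRoot))⁻¹ : ℝ) : ℂ) ≠ 0 := by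
    exact_mod_cast inv_ne_zero (Real.sqrt_pos.2 hpos).ne'
  have hk : (Q.kappa⁻¹ : SL(2, ℝ)).1 =
      (√(Q.root - Q.conjRoot))⁻¹ • !![-Q.conjRoot, Q.root; -1, 1] := by
    rw [Matrix.SpecialLinearGroup.coe_inv]
    simp [kappa, Matrix.adjugate_fin_two]
  rw [liftPoint, UpperHalfPlane.coe_specialLinearGroup_apply]
  refine Eq.trans ?_ (mul_div_mul_left _ _ hr)
  simp [hk]
  ring

/-- `κ` maps the geodesic of `Q` into the imaginary axis. -/
theorem kappa_smul_re [PosFundDisc D] (Q : QForm D) {z : ℍ} (hz : z ∈ Q.geodesic) :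
    (Q.kappa • z : ℍ).re = 0 := by
  have ha : (Q.a : ℝ) ≠ 0 := by exact_mod_cast Q.a_ne_zero
  have h : (Q.a : ℝ) * Complex.normSq (z : ℂ) + Q.b * (z : ℂ).re + Q.c = 0 := hz
  rw [Complex.normSq_apply] at h
  change ((Q.kappa • z : ℍ) : ℂ).re = 0
  rw [coe_kappa_smul, Complex.div_re, ← add_div]
  simp only [Complex.sub_re, Complex.sub_im, Complex.ofReal_re, Complex.ofReal_im, sub_zero]
  rw [div_eq_zero_iff]
  left
  apply mul_left_cancel₀ ha
  linear_combination h - (z : ℂ).re * Q.root_add_conjRoot + Q.root_mul_conjRoot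

theorem im_kappa_smul_liftPoint [PosFundDisc D] (Q : QForm D) (y : ℝ) (hy : 0 < y) :
    (Q.kappa • Q.liftPoint y hy : ℍ).im = y := by
  rw [liftPoint, smul_inv_smul]
  change (Complex.I * (y : ℂ)).im = y
  simp

theorem liftPoint_im_kappa_smul [PosFundDisc D] (Q : QForm D) {z : ℍ} (hz : z ∈ Q.geodesic) :
    Q.liftPoint (Q.kappa • z : ℍ).im (Q.kappa • z : ℍ).im_pos = z := by
  rw [liftPoint, inv_smul_eq_iff]
  ext
  change Complex.I * (((Q.kappa • z : ℍ).im : ℝ) : ℂ) = ((Q.kappa • z : ℍ) : ℂ)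
  have h := Q.kappa_smul_re hz
  apply Complex.ext
  · simpa using h.symm
  · simp

/-- The parametrization of the geodesic of `Q` by arc length, `t ↦ κ⁻¹ · i eᵗ`. -/
noncomputable def param [PosFundDisc D] (Q : QForm D) : ℝ ≃ᵢ Q.geodesic where
  toFun t := ⟨Q.liftPoint (Real.exp t) (Real.exp_pos t), Q.liftPoint_mem _ _⟩
  invFun z := Real.log (Q.kappa • (z : ℍ)).im
  left_inv t := by
    change Real.log (Q.kappa • Q.liftPoint (Real.exp t) (Real.exp_pos t) : ℍ).im = t
    rw [im_kappa_smul_liftPoint, Real.log_exp]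
  right_inv z := by
    apply Subtype.ext
    simp only [Real.exp_log (Q.kappa • (z : ℍ)).im_pos]
    exact Q.liftPoint_im_kappa_smul z.2
  isometry_toFun := Isometry.of_dist_eq fun s t => by
    change dist (Q.liftPoint (Real.exp s) (Real.exp_pos s))
      (Q.liftPoint (Real.exp t) (Real.exp_pos t)) = _
    rw [liftPoint, liftPoint, dist_smul, UpperHalfPlane.dist_of_re_eq]
    · change dist (Real.log (Complex.I * (Real.exp s : ℂ)).im)
        (Real.log (Complex.I * (Real.exp t : ℂ)).im) = _
      simp [-Complex.ofReal_exp]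
    · change (Complex.I * (Real.exp s : ℂ)).re = (Complex.I * (Real.exp t : ℂ)).re
      simp [-Complex.ofReal_exp]

theorem coe_param [PosFundDisc D] (Q : QForm D) (t : ℝ) :
    (Q.param t : ℍ) = Q.liftPoint (Real.exp t) (Real.exp_pos t) := rfl

/-- The closed geodesic of the class of `Q`, parametrized by arc length. -/
noncomputable def curve [PosFundDisc D] (Q : QForm D) (t : ℝ) : GeodesicUnion D :=
  Q.proj (Q.param t)

theorem along_exp [PosFundDisc D] (Q : QForm D) (g : GeodesicUnion D → ℂ) (t : ℝ) :
    Q.along g (Real.exp t) = g (Q.curve t) :=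
  dif_pos (Real.exp_pos t)

theorem measurable_proj (Q : QForm D) : Measurable Q.proj :=
  (measurable_quotient_mk' (s := markedSetoid D)).comp
    ((measurable_const.prodMk measurable_subtype_coe).subtype_mk)

theorem measurable_curve [PosFundDisc D] (Q : QForm D) : Measurable Q.curve :=
  Q.measurable_proj.comp Q.param.continuous.measurable

/-- The arc length measure is the image of Lebesgue measure on one period. The half-open interval
may be closed on either side, as points have measure zero. -/
theorem arcLength_eq_map [PosFundDisc D] (Q : QForm D) :
    Q.arcLength =
      (volume.restrict (Set.Ioc 0 (period D))).map Q.curve := by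
  have hpre : Q.param ⁻¹' Q.fundamentalArc = Set.Ico 0 (period D) := by
    ext t
    change 1 ≤ (Q.kappa • Q.liftPoint (Real.exp t) (Real.exp_pos t) : ℍ).im ∧
      (Q.kappa • Q.liftPoint (Real.exp t) (Real.exp_pos t) : ℍ).im < epsilonD D ^ 2 ↔ _
    rw [im_kappa_smul_liftPoint, Real.one_le_exp_iff, ← exp_period, Real.exp_lt_exp]
    rfl
  have hemb : MeasurableEmbedding Q.param :=
    Q.param.toHomeomorph.measurableEmbedding
  rw [arcLength, ← Q.param.map_hausdorffMeasure, hausdorffMeasure_real, hemb.restrict_map, hpre,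
    Measure.restrict_congr_set Ico_ae_eq_Ioc, Measure.map_map Q.measurable_proj hemb.measurable]
  rfl

/-- `A` maps the geodesic of `Q ∘ A` to the geodesic of `Q`. -/
theorem IsTranslate.smul_mem_geodesic {Q Q' : QForm D} {A : SL(2, ℤ)} (h : Q.IsTranslate Q' A)
    {z : ℍ} (hz : z ∈ Q'.geodesic) : A • z ∈ Q.geodesic := by
  obtain ⟨ea, eb, ec⟩ := h.coeffs
  have ha : (Q'.a : ℝ) = Q.a * A 0 0 ^ 2 + Q.b * A 0 0 * A 1 0 + Q.c * A 1 0 ^ 2 := by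
    rw [ea]; push_cast; ring
  have hb : (Q'.b : ℝ) = 2 * Q.a * A 0 0 * A 0 1 + Q.b * (A 0 0 * A 1 1 + A 0 1 * A 1 0) +
      2 * Q.c * A 1 0 * A 1 1 := by rw [eb]; push_cast; ring
  have hc : (Q'.c : ℝ) = Q.a * A 0 1 ^ 2 + Q.b * A 0 1 * A 1 1 + Q.c * A 1 1 ^ 2 := by
    rw [ec]; push_cast; ring
  have h1 : (Q'.a : ℝ) * Complex.normSq (z : ℂ) + Q'.b * (z : ℂ).re + Q'.c = 0 := hz
  change (Q.a : ℝ) * Complex.normSq ((A • z : ℍ) : ℂ) + Q.b * ((A • z : ℍ) : ℂ).re + Q.c = 0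
  have hden : ((A 1 0 : ℝ) : ℂ) * z + ((A 1 1 : ℝ) : ℂ) ≠ 0 := by
    intro h0
    have him := congrArg Complex.im h0
    have hre := congrArg Complex.re h0
    simp only [Complex.add_im, Complex.mul_im, Complex.ofReal_re, Complex.ofReal_im, zero_mul,
      add_zero, Complex.zero_im, Complex.add_re, Complex.mul_re, sub_zero,
      Complex.zero_re] at him hre
    have h10 : (A 1 0 : ℝ) = 0 := by
      rcases mul_eq_zero.1 him with h | h
      · exact h
      · exact absurd h z.im_pos.ne'
    rw [h10, zero_mul, zero_add] at hre
    have hd := det_eq_one A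
    have h10' : A 1 0 = 0 := by exact_mod_cast h10
    have h11' : A 1 1 = 0 := by exact_mod_cast hre
    rw [h10', h11'] at hd
    simp at hd
  have hN : Complex.normSq (((A 1 0 : ℝ) : ℂ) * z + ((A 1 1 : ℝ) : ℂ)) ≠ 0 := by
    simpa using hden
  rw [UpperHalfPlane.coe_specialLinearGroup_apply]
  simp only [algebraMap_int_eq, eq_intCast, map_div₀, Complex.div_re]
  rw [← add_div]
  apply mul_right_cancel₀ hN
  rw [zero_mul, add_mul, add_mul, mul_assoc, div_mul_cancel₀ _ hN, mul_assoc, div_mul_cancel₀ _ hN]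
  rw [Complex.normSq_apply] at h1
  simp only [Complex.normSq_apply, Complex.add_re, Complex.mul_re, Complex.add_im, Complex.mul_im,
    Complex.ofReal_re, Complex.ofReal_im]
  rw [ha, hb, hc] at h1
  linear_combination h1

theorem isometry_sl2z_smul (A : SL(2, ℤ)) : Isometry (fun z : ℍ => A • z) := by
  have : ∀ z : ℍ, A • z =
      (Matrix.SpecialLinearGroup.map (Int.castRingHom ℝ) A : SL(2, ℝ)) • z := fun z => by
    ext
    rw [UpperHalfPlane.coe_specialLinearGroup_apply, UpperHalfPlane.coe_specialLinearGroup_apply]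
    simp
  simp only [this]
  exact isometry_smul _ _

/-- An isometry of the real line is a translation or a reflection. -/
theorem eq_add_or_eq_sub_of_isometry {φ : ℝ → ℝ} (h : Isometry φ) :
    ∃ c, (∀ t, φ t = c + t) ∨ ∀ t, φ t = c - t := by
  have hd : ∀ s t, (φ s - φ t) ^ 2 = (s - t) ^ 2 := fun s t => by
    rw [← sq_abs, ← sq_abs (s - t), ← Real.dist_eq, ← Real.dist_eq, h.dist_eq]
  refine ⟨φ 0, ?_⟩
  have h1 := hd 1 0
  rcases sq_eq_sq_iff_eq_or_eq_neg.1 h1 with h1 | h1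
  · left; intro t
    have h2 := hd t 1
    rw [show φ 1 = φ 0 + 1 by linarith] at h2
    linear_combination (hd t 0 - h2) / 2
  · right; intro t
    have h2 := hd t 1
    rw [show φ 1 = φ 0 - 1 by linarith] at h2
    linear_combination (h2 - hd t 0) / 2

/-- Equivalent forms parametrize the same closed geodesic, up to a shift and the direction. The
direction changes exactly when the first coefficients have opposite signs. -/
theorem IsTranslate.curve_eq [PosFundDisc D] {Q Q' : QForm D} {A : SL(2, ℤ)}
    (h : Q.IsTranslate Q' A) :
    ∃ c, (∀ t, Q'.curve t = Q.curve (c + t)) ∨ ∀ t, Q'.curve t = Q.curve (c - t) := by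
  let φ : ℝ → ℝ := fun t => Q.param.symm ⟨A • (Q'.param t : ℍ), h.smul_mem_geodesic (Q'.param t).2⟩
  have hφ : Isometry φ := by
    refine Q.param.symm.isometry.comp (Isometry.of_dist_eq fun s t => ?_)
    have h1 := (isometry_sl2z_smul A).dist_eq (Q'.param s : ℍ) (Q'.param t)
    have h2 := Q'.param.isometry.dist_eq s t
    exact h1.trans h2
  have hc : ∀ t, Q'.curve t = Q.curve (φ t) := fun t => by
    rw [curve, curve]
    simp only [φ, IsometryEquiv.apply_symm_apply]
    exact (Quotient.sound (s := markedSetoid D) ⟨A, h, rfl⟩).symm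
  obtain ⟨c, hc' | hc'⟩ := eq_add_or_eq_sub_of_isometry hφ
  · exact ⟨c, Or.inl fun t => by rw [hc, hc']⟩
  · exact ⟨c, Or.inr fun t => by rw [hc, hc']⟩

/-- The automorph of `Q` attached to the unit `ε_D = (t + s √D) / 2` translates the geodesic of `Q`
by the length `log ε_D²`. -/
theorem curve_periodic [hD : PosFundDisc D] (Q : QForm D) :
    Function.Periodic Q.curve (period D) := by
  obtain ⟨t, s, hε, hp⟩ := epsilonD_pell D
  have hε0 : 0 < epsilonD D := zero_lt_one.trans (one_lt_epsilonD D)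
  have hdisc := Q.disc
  obtain ⟨k, hk⟩ : ∃ k, t = 2 * k + Q.b * s := by
    obtain ⟨k, hk⟩ := Q.even_sub (t := t) (u := s) ⟨1, hp⟩
    exact ⟨k, by linarith⟩
  have hdet : k * (k + Q.b * s) - -(Q.c * s) * (Q.a * s) = 1 := by
    rw [hk] at hp
    apply mul_left_cancel₀ (show (4 : ℤ) ≠ 0 by norm_num)
    linear_combination hp - s ^ 2 * hdisc
  let A : SL(2, ℤ) :=
    ⟨!![k, -(Q.c * s); Q.a * s, k + Q.b * s], by rw [Matrix.det_fin_two_of, hdet]⟩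
  have hA : Q.IsTranslate Q A := fun x y => by
    simp only [A, eval, Matrix.of_apply, Matrix.cons_val', Matrix.cons_val_zero,
      Matrix.cons_val_fin_one, Matrix.cons_val_one]
    linear_combination -(Q.a * x ^ 2 + Q.b * x * y + Q.c * y ^ 2) * hdet
  -- the eigenvalues of `A` at the eigenvectors `(ω, 1)` and `(ω*, 1)`
  set l : ℝ := Q.a * s * Q.root + (k + Q.b * s) with hl
  set m : ℝ := Q.a * s * Q.conjRoot + (k + Q.b * s) with hm
  have hdet' : (k * (k + Q.b * s) + Q.c * s * (Q.a * s) : ℝ) = 1 := by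
    have : k * (k + Q.b * s) + Q.c * s * (Q.a * s) = 1 := by linarith
    exact_mod_cast this
  have hlm : l * m = 1 := by
    rw [hl, hm]
    linear_combination hdet' + s ^ 2 * Q.a * Q.root_mul_conjRoot +
      s * (k + Q.b * s) * Q.root_add_conjRoot
  have hroot : k * Q.root - Q.c * s = Q.root * l := by
    rw [hl]; linear_combination -s * Q.root_eq.1
  have hconj : k * Q.conjRoot - Q.c * s = Q.conjRoot * m := by
    rw [hm]; linear_combination -s * Q.root_eq.2
  have hl0 : l ≠ 0 := left_ne_zero_of_mul_eq_one hlm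
  have hm0 : m ≠ 0 := right_ne_zero_of_mul_eq_one hlm
  have hmove : ∀ (y : ℝ) (hy : 0 < y),
      A • Q.liftPoint y hy = Q.liftPoint (y * m ^ 2) (by positivity) := fun y hy => by
    ext
    have hl0' : (l : ℂ) ≠ 0 := by exact_mod_cast hl0
    have hlm' : (l * m : ℂ) = 1 := by exact_mod_cast hlm
    have hroot' : (k * Q.root - Q.c * s : ℂ) = Q.root * l := by exact_mod_cast hroot
    have hconj' : (k * Q.conjRoot - Q.c * s : ℂ) = Q.conjRoot * m := by exact_mod_cast hconj
    have hl' : (l : ℂ) = Q.a * s * Q.root + (k + Q.b * s) := by rw [hl]; push_cast; ring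
    have hm' : (m : ℂ) = Q.a * s * Q.conjRoot + (k + Q.b * s) := by rw [hm]; push_cast; ring
    have h0 := one_sub_I_mul_ne_zero y
    rw [UpperHalfPlane.coe_specialLinearGroup_apply, coe_liftPoint, coe_liftPoint]
    simp only [A, Matrix.of_apply, Matrix.cons_val', Matrix.cons_val_zero,
      Matrix.cons_val_fin_one, Matrix.cons_val_one, algebraMap_int_eq, eq_intCast]
    rw [← mul_div_mul_right _ _ h0, add_mul, add_mul, mul_assoc, mul_assoc, div_mul_cancel₀ _ h0]
    rw [← mul_div_mul_left (-Q.conjRoot * (Complex.I * ((y * m ^ 2 : ℝ) : ℂ)) + Q.root : ℂ) _ hl0']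
    congr 1
    · push_cast
      linear_combination (-Complex.I * y) * hconj' + hroot' +
        (Q.conjRoot * Complex.I * y * m) * hlm'
    · push_cast
      linear_combination (Complex.I * y * m) * hlm' + Complex.I * y * hm' - hl'
  have hshift : ∀ r : ℝ, Q.curve (r + 2 * Real.log |m|) = Q.curve r := fun r => by
    have h1 : A • (Q.param r : ℍ) = (Q.param (r + 2 * Real.log |m|) : ℍ) := by
      rw [coe_param, coe_param, hmove]
      congr 1
      rw [Real.exp_add, two_mul, Real.exp_add, Real.exp_log (abs_pos.2 hm0), abs_mul_abs_self, sq]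
    exact Quotient.sound (s := markedSetoid D) ⟨A, hA, h1.symm⟩
  have hD2 : √(D : ℝ) ^ 2 = D := Real.sq_sqrt (by exact_mod_cast hD.pos.le)
  have hp' : (t ^ 2 - D * s ^ 2 : ℝ) = 4 := by exact_mod_cast hp
  have hk' : (t : ℝ) = 2 * k + Q.b * s := by exact_mod_cast hk
  have hinv : (epsilonD D)⁻¹ = (t - s * √(D : ℝ)) / 2 := by
    rw [inv_eq_iff_eq_inv, eq_comm]
    apply inv_eq_of_mul_eq_one_right
    rw [hε]
    linear_combination hp' / 4 - (s ^ 2 / 4 : ℝ) * hD2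
  have ha : (Q.a : ℝ) ≠ 0 := by exact_mod_cast Q.a_ne_zero
  rcases abs_choice (Q.a : ℝ) with h | h
  · have hm1 : m = (epsilonD D)⁻¹ := by
      rw [hinv, hm, conjRoot, h, hk']
      field_simp
      ring
    intro r
    have := hshift (r + period D)
    rw [hm1, abs_of_pos (inv_pos.2 hε0), Real.log_inv] at this
    rw [← this, period]
    congr 1
    ring
  · have hm1 : m = epsilonD D := by
      rw [hε, hm, conjRoot, h, hk']
      field_simp
      ring
    intro r
    have := hshift r
    rwa [hm1, abs_of_pos hε0] at this

end QForm

/-! ### Characters of finite abelian groups -/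

/-- Orthogonality of the characters of a finite abelian group. -/
theorem sum_monoidHom_apply {G : Type*} [CommGroup G] [Finite G] [DecidableEq G]
    [Fintype (G →* ℂˣ)] (a : G) :
    ∑ ψ : G →* ℂˣ, ((ψ a : ℂˣ) : ℂ) = if a = 1 then (Nat.card G : ℂ) else 0 := by
  split_ifs with h
  · subst h
    simp [← CommGroup.card_monoidHom_of_hasEnoughRootsOfUnity G ℂ]
  · obtain ⟨φ, hφ⟩ := CommGroup.exists_apply_ne_one_of_hasEnoughRootsOfUnity G ℂ h
    have h1 : ((φ a : ℂˣ) : ℂ) * ∑ ψ : G →* ℂˣ, ((ψ a : ℂˣ) : ℂ) =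
        ∑ ψ : G →* ℂˣ, ((ψ a : ℂˣ) : ℂ) := by
      rw [Finset.mul_sum]
      exact Fintype.sum_equiv (Equiv.mulLeft φ) _ _ fun ψ => by simp
    have h2 : ((φ a : ℂˣ) : ℂ) ≠ 1 := fun h => hφ (Units.ext h)
    by_contra h0
    exact h2 (mul_right_cancel₀ h0 (h1.trans (one_mul _).symm))

/-- Plancherel's formula for the group of characters of a finite abelian group. -/
theorem sum_monoidHom_norm_sq {G : Type*} [CommGroup G] [Fintype G] [Fintype (G →* ℂˣ)]
    (c : G → ℂ) :
    ∑ ψ : G →* ℂˣ, ‖∑ a, (((ψ a)⁻¹ : ℂˣ) : ℂ) * c a‖ ^ 2 = Nat.card G * ∑ a, ‖c a‖ ^ 2 := by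
  classical
  have hconj : ∀ (ψ : G →* ℂˣ) (b : G),
      (starRingEnd ℂ) ((ψ b : ℂˣ) : ℂ)⁻¹ = ((ψ b : ℂˣ) : ℂ) := fun ψ b => by
    have h1 : ((ψ b : ℂˣ) : ℂ) ^ Nat.card G = 1 := by
      rw [← Units.val_pow_eq_pow_val, ← map_pow, pow_card_eq_one', map_one, Units.val_one]
    have h2 : ‖((ψ b : ℂˣ) : ℂ)‖ = 1 := Complex.norm_eq_one_of_pow_eq_one h1 Nat.card_pos.ne'
    rw [map_inv₀, Complex.inv_def, Complex.conj_conj,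
      Complex.normSq_conj, Complex.normSq_eq_norm_sq, h2]
    simp
  apply Complex.ofReal_injective
  push_cast
  simp only [← Complex.mul_conj', map_sum, map_mul, hconj, Finset.sum_mul_sum]
  rw [Finset.sum_comm, Finset.mul_sum]
  refine Finset.sum_congr rfl fun a _ => ?_
  rw [Finset.sum_comm]
  have : ∀ b, ∑ ψ : G →* ℂˣ, ((ψ a : ℂˣ) : ℂ)⁻¹ * c a *
      (((ψ b : ℂˣ) : ℂ) * (starRingEnd ℂ) (c b)) =
      (if a⁻¹ * b = 1 then (Nat.card G : ℂ) else 0) * (c a * (starRingEnd ℂ) (c b)) := fun b => by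
    rw [← sum_monoidHom_apply, Finset.sum_mul]
    refine Finset.sum_congr rfl fun ψ _ => ?_
    rw [map_mul, map_inv, Units.val_mul, Units.val_inv_eq_inv_val]
    ring
  simp only [this, inv_mul_eq_one]
  simp

/-! ### The arc length measure -/

namespace QForm

instance [PosFundDisc D] (Q : QForm D) : IsFiniteMeasure Q.arcLength := by
  rw [arcLength_eq_map]; infer_instance

theorem arcLength_real [PosFundDisc D] (Q : QForm D) {S : Set (GeodesicUnion D)}
    (hS : MeasurableSet S) :
    Q.arcLength.real S = ∫ t in (0 : ℝ)..period D, S.indicator (fun _ => (1 : ℝ)) (Q.curve t) := by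
  rw [intervalIntegral.integral_of_le (period_pos D).le, ← integral_indicator_one hS,
    arcLength_eq_map, integral_map Q.measurable_curve.aemeasurable]
  · rfl
  · exact (stronglyMeasurable_one.indicator hS).aestronglyMeasurable

/-- The arc length measure does not depend on the form chosen in its class, since a change of form
reparametrizes the closed geodesic by a shift, possibly with a change of direction. -/
theorem IsTranslate.arcLength_eq [PosFundDisc D] {Q Q' : QForm D} {A : SL(2, ℤ)}
    (h : Q.IsTranslate Q' A) : Q'.arcLength = Q.arcLength := by
  ext S hS
  rw [← measureReal_eq_measureReal_iff, arcLength_real _ hS, arcLength_real _ hS]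
  set F : ℝ → ℝ := fun t => S.indicator (fun _ => (1 : ℝ)) (Q.curve t) with hF
  have hper : Function.Periodic F (period D) := fun t => by
    simp only [hF, Q.curve_periodic t]
  have hall : ∀ c, ∫ t in c..c + period D, F t = ∫ t in (0 : ℝ)..period D, F t := fun c => by
    rw [hper.intervalIntegral_add_eq c 0, zero_add]
  obtain ⟨c, hc | hc⟩ := h.curve_eq
  · simp only [hc]
    change ∫ t in (0 : ℝ)..period D, F (c + t) = _
    rw [intervalIntegral.integral_comp_add_left, add_zero, hall]
  · simp only [hc]
    change ∫ t in (0 : ℝ)..period D, F (c - t) = _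
    rw [intervalIntegral.integral_comp_sub_left, sub_zero, ← hall (c - period D), sub_add_cancel]

end QForm

/-- Forms and narrow ideal classes correspond: a choice of a form for every ideal class is a choice
of a form in every class of forms. -/
theorem bijective_formClass [PosFundDisc D] {Q : NarrowClassGroup D → QForm D}
    (hQ : ∀ 𝔞, (Q 𝔞).idealClass = 𝔞) :
    Function.Bijective fun 𝔞 => (Quotient.mk (formSetoid D) (Q 𝔞) : FormClass D) := by
  constructor
  · intro 𝔞 𝔟 h
    obtain ⟨A, hA⟩ := Quotient.exact h
    rw [← hQ 𝔞, ← hQ 𝔟]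
    exact QForm.idealClass_eq_of_isTranslate hA
  · intro C
    induction C using Quotient.inductionOn with
    | h F => exact ⟨F.idealClass, Quotient.sound
        (QForm.exists_isTranslate_of_idealClass_eq (hQ _))⟩

theorem arcLength_eq_sum [PosFundDisc D] {Q : NarrowClassGroup D → QForm D}
    (hQ : ∀ 𝔞, (Q 𝔞).idealClass = 𝔞) :
    arcLength D = ∑ 𝔞, (Q 𝔞).arcLength := by
  rw [← Measure.sum_fintype, arcLength]
  ext S hS
  rw [Measure.sum_apply _ hS, Measure.sum_apply _ hS]
  refine ((Equiv.ofBijective _ (bijective_formClass hQ)).tsum_eq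
    fun C : FormClass D => (Quotient.out C : QForm D).arcLength S).symm.trans ?_
  refine tsum_congr fun 𝔞 => ?_
  obtain ⟨A, hA⟩ := Quotient.exact (Quotient.out_eq (Quotient.mk (formSetoid D) (Q 𝔞)))
  exact congrArg (fun μ : Measure (GeodesicUnion D) => μ S) hA.arcLength_eq.symm

theorem totalLength_eq [PosFundDisc D] :
    totalLength D = Nat.card (NarrowClassGroup D) * period D := by
  choose Q hQ using exists_idealClass_eq (D := D)
  rw [totalLength, arcLength_eq_sum hQ, measureReal_def, Measure.finsetSum_apply,
    ENNReal.toReal_sum fun _ _ => measure_ne_top _ _]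
  have : ∀ 𝔞, ((Q 𝔞).arcLength Set.univ).toReal = period D := fun 𝔞 => by
    rw [← measureReal_def, QForm.arcLength_real _ MeasurableSet.univ]
    simp
  simp [this]

theorem memLp_curve [PosFundDisc D] {Q : NarrowClassGroup D → QForm D}
    (hQ : ∀ 𝔞, (Q 𝔞).idealClass = 𝔞) (g : Lp ℂ 2 (arcLength D))
    (𝔞 : NarrowClassGroup D) :
    MemLp (fun t => g ((Q 𝔞).curve t)) 2 (volume.restrict (Set.Ioc 0 (period D))) := by
  have h1 : (Q 𝔞).arcLength ≤ arcLength D := by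
    rw [arcLength_eq_sum hQ, ← Measure.sum_fintype]
    exact Measure.le_sum _ 𝔞
  have h2 := (Lp.memLp g).mono_measure h1
  rw [QForm.arcLength_eq_map] at h2
  exact h2.comp_of_map (Q 𝔞).measurable_curve.aemeasurable

theorem integral_arcLength_eq_sum [PosFundDisc D] {Q : NarrowClassGroup D → QForm D}
    (hQ : ∀ 𝔞, (Q 𝔞).idealClass = 𝔞) {f : GeodesicUnion D → ℝ} (hf : StronglyMeasurable f)
    (hfi : Integrable f (arcLength D)) :
    ∫ x, f x ∂arcLength D = ∑ 𝔞, ∫ t in (0 : ℝ)..period D, f ((Q 𝔞).curve t) := by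
  rw [arcLength_eq_sum hQ] at hfi ⊢
  rw [integral_finsetSum_measure fun 𝔞 _ => ?_]
  · refine Finset.sum_congr rfl fun 𝔞 _ => ?_
    rw [intervalIntegral.integral_of_le (period_pos D).le, QForm.arcLength_eq_map,
      integral_map (Q 𝔞).measurable_curve.aemeasurable hf.aestronglyMeasurable]
  · refine hfi.mono_measure ?_
    rw [← Measure.sum_fintype]
    exact Measure.le_sum _ 𝔞

theorem norm_sq_eq_sum [PosFundDisc D] {Q : NarrowClassGroup D → QForm D}
    (hQ : ∀ 𝔞, (Q 𝔞).idealClass = 𝔞) (g : Lp ℂ 2 (arcLength D)) :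
    ‖g‖ ^ 2 = ∑ 𝔞, ∫ t in (0 : ℝ)..period D, ‖g ((Q 𝔞).curve t)‖ ^ 2 := by
  have h1 : ‖g‖ ^ 2 = ∫ x, ‖g x‖ ^ 2 ∂arcLength D := by
    have h2 := @inner_self_eq_norm_sq ℂ _ _ _ _ g
    rw [← h2, L2.inner_def, ← integral_re (L2.integrable_inner g g)]
    exact integral_congr_ae (Filter.Eventually.of_forall fun x =>
      inner_self_eq_norm_sq (𝕜 := ℂ) (g x))
  have hsm : StronglyMeasurable fun x => ‖g x‖ ^ 2 := (Lp.stronglyMeasurable g).norm.pow 2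
  have hint : Integrable (fun x => ‖g x‖ ^ 2) (arcLength D) :=
    (Lp.memLp g).integrable_norm_pow two_ne_zero
  rw [h1, integral_arcLength_eq_sum hQ hsm hint]

/-! ### Fourier expansion along a closed geodesic -/

theorem exp_image_Ioc [PosFundDisc D] :
    Real.exp '' Set.Ioc 0 (period D) = Set.Ioc 1 (epsilonD D ^ 2) := by
  rw [← exp_period]
  ext y
  constructor
  · rintro ⟨t, ⟨h1, h2⟩, rfl⟩
    exact ⟨Real.one_lt_exp_iff.2 h1, Real.exp_le_exp.2 h2⟩
  · rintro ⟨h1, h2⟩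
    have h0 : 0 < y := zero_lt_one.trans h1
    exact ⟨Real.log y, ⟨Real.log_pos h1, (Real.log_le_iff_le_exp h0).2 h2⟩, Real.exp_log h0⟩

/-- The substitution `y = eᵗ` turns the Mellin kernel into the `n`-th Fourier mode of period
`log ε_D²`. -/
theorem exp_smul_twistedIntegrand [PosFundDisc D] (Q : QForm D) (g : GeodesicUnion D → ℂ) (n : ℤ)
    (t : ℝ) :
    |Real.exp t| • twistedIntegrand Q g n (Real.exp t) =
      fourier (-n) (t : AddCircle (period D - 0)) • g (Q.curve t) := by
  have h0 : (Real.exp t : ℂ) ≠ 0 := by exact_mod_cast (Real.exp_pos t).ne'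
  have hl : (Real.log (epsilonD D) : ℂ) ≠ 0 := by
    exact_mod_cast (Real.log_pos (one_lt_epsilonD D)).ne'
  rw [abs_of_pos (Real.exp_pos t), twistedIntegrand, QForm.along_exp, fourier_coe_apply,
    Complex.real_smul, mul_div_cancel₀ _ h0, smul_eq_mul, mul_comm,
    Complex.cpow_def_of_ne_zero h0, ← Complex.ofReal_log (Real.exp_pos t).le, Real.log_exp]
  congr 2
  rw [sub_zero, period]
  push_cast
  field_simp

theorem intervalIntegrable_twistedIntegrand [PosFundDisc D] (Q : QForm D)
    {g : GeodesicUnion D → ℂ}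
    (hg : MemLp (fun t => g (Q.curve t)) 2 (volume.restrict (Set.Ioc 0 (period D)))) (n : ℤ) :
    IntervalIntegrable (twistedIntegrand Q g n) volume 1 (epsilonD D ^ 2) := by
  have hε : 1 ≤ epsilonD D ^ 2 := one_le_pow₀ (one_lt_epsilonD D).le
  rw [intervalIntegrable_iff_integrableOn_Ioc_of_le hε, ← exp_image_Ioc,
    integrableOn_image_iff_integrableOn_abs_deriv_smul measurableSet_Ioc
      (fun t _ => (Real.hasDerivAt_exp t).hasDerivWithinAt) Real.exp_injective.injOn]
  simp only [exp_smul_twistedIntegrand]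
  have h1 : Integrable (fun t => g (Q.curve t)) (volume.restrict (Set.Ioc 0 (period D))) :=
    hg.integrable one_le_two
  have h2 : AEStronglyMeasurable (fun t : ℝ => fourier (-n) (t : AddCircle (period D - 0)))
      (volume.restrict (Set.Ioc 0 (period D))) :=
    ((fourier (-n)).continuous.comp (AddCircle.continuous_mk' _)).aestronglyMeasurable
  refine h1.norm.mono' (h2.smul h1.1) (Filter.Eventually.of_forall fun t => ?_)
  · rw [norm_smul, fourier_apply, Circle.norm_coe, one_mul]

theorem integral_twistedIntegrand [PosFundDisc D] (Q : QForm D) (g : GeodesicUnion D → ℂ) (n : ℤ) :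
    ∫ y in (1 : ℝ)..epsilonD D ^ 2, twistedIntegrand Q g n y =
      period D • fourierCoeffOn (period_pos D) (fun t => g (Q.curve t)) n := by
  have hε : 1 ≤ epsilonD D ^ 2 := one_le_pow₀ (one_lt_epsilonD D).le
  rw [intervalIntegral.integral_of_le hε, ← exp_image_Ioc,
    integral_image_eq_integral_abs_deriv_smul measurableSet_Ioc
      (fun t _ => (Real.hasDerivAt_exp t).hasDerivWithinAt) Real.exp_injective.injOn]
  simp only [exp_smul_twistedIntegrand]
  rw [fourierCoeffOn_eq_integral, smul_smul, ← intervalIntegral.integral_of_le (period_pos D).le,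
    sub_zero, mul_one_div_cancel (period_pos D).ne', one_smul]

/-- Parseval's identity on one closed geodesic. -/
theorem hasSum_norm_sq_integral [PosFundDisc D] (Q : QForm D) {g : GeodesicUnion D → ℂ}
    (hg : MemLp (fun t => g (Q.curve t)) 2 (volume.restrict (Set.Ioc 0 (period D)))) :
    HasSum (fun n : ℤ => ‖∫ y in (1 : ℝ)..epsilonD D ^ 2, twistedIntegrand Q g n y‖ ^ 2)
      (period D * ∫ t in (0 : ℝ)..period D, ‖g (Q.curve t)‖ ^ 2) := by
  have h := (hasSum_sq_fourierCoeffOn (period_pos D) hg).mul_left (period D ^ 2)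
  have hL := (period_pos D).ne'
  rw [sub_zero, smul_eq_mul, ← mul_assoc, sq, mul_inv_cancel_right₀ hL, ← sq] at h
  simpa only [integral_twistedIntegrand, norm_smul, mul_pow, Real.norm_eq_abs, sq_abs] using h

end RestrictionNorm

theorem mainTheorem2 (D : ℤ) [RestrictionNorm.PosFundDisc D] :
    (∃ Q : RestrictionNorm.NarrowClassGroup D → RestrictionNorm.QForm D,
      ∀ 𝔞, (Q 𝔞).idealClass = 𝔞) ∧
    ∀ Q : RestrictionNorm.NarrowClassGroup D → RestrictionNorm.QForm D,
      (∀ 𝔞, (Q 𝔞).idealClass = 𝔞) →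
      ∀ g : MeasureTheory.Lp ℂ 2 (RestrictionNorm.arcLength D),
        (∀ 𝔞 n, IntervalIntegrable (RestrictionNorm.twistedIntegrand (Q 𝔞) g n)
          MeasureTheory.volume 1 (RestrictionNorm.epsilonD D ^ 2)) ∧
        (∀ ψ, Summable fun n : ℤ => RestrictionNorm.periodSq Q g ψ n) ∧
        ‖g‖ ^ 2 = (RestrictionNorm.totalLength D)⁻¹ *
          ∑ ψ : RestrictionNorm.NarrowClassGroup D →* ℂˣ,
            ∑' n : ℤ, RestrictionNorm.periodSq Q g ψ n := by
  open RestrictionNorm in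
  refine ⟨Classical.axiomOfChoice exists_idealClass_eq, fun Q hQ g => ?_⟩
  have hmem := memLp_curve hQ g
  have hsum : HasSum (fun n : ℤ => ∑ ψ, periodSq Q g ψ n)
      (Nat.card (NarrowClassGroup D) * (period D * ‖g‖ ^ 2)) := by
    rw [norm_sq_eq_sum hQ g, Finset.mul_sum]
    simp only [periodSq, sum_monoidHom_norm_sq]
    exact (hasSum_sum fun 𝔞 _ => hasSum_norm_sq_integral (Q 𝔞) (hmem 𝔞)).mul_left _
  have hsummable : ∀ ψ, Summable fun n : ℤ => periodSq Q g ψ n := fun ψ =>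
    hsum.summable.of_nonneg_of_le (fun n => sq_nonneg _) fun n =>
      Finset.single_le_sum (f := fun ψ => periodSq Q g ψ n) (fun ψ _ => sq_nonneg _)
        (Finset.mem_univ ψ)
  refine ⟨fun 𝔞 n => intervalIntegrable_twistedIntegrand (Q 𝔞) (hmem 𝔞) n, hsummable, ?_⟩
  rw [← Summable.tsum_finsetSum fun ψ _ => hsummable ψ, hsum.tsum_eq, totalLength_eq]
  have hL := (period_pos D).ne'
  have hcard : (Nat.card (NarrowClassGroup D) : ℝ) ≠ 0 := by exact_mod_cast Nat.card_pos.ne'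
  field_simp
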